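/- Let $t_1,\dots,t_N\in\mathbb{R}$ be measurement times, and consider measurement settings $x\in\{1,\dots,X\}$ with outcomes $a\in\{1,\dots,A\}$, $A\ge 1$. A *dataset* is a family of numbers $P(a|x,t_j)\ge 0$ with $\sum_a P(a|x,t_j)=1$ for all $x,j$. A *quantum realization* of $P$ is a tuple $(\mathcal H,\rho,H,M)$ consisting of a complex Hilbert space $\mathcal H$, a density operator $\rho$ on $\mathcal H$, a (possibly unbounded) self-adjoint operator $H\ge 0$ and POVMs $(M_{a|x})_a$ on $\mathcal H$ (that is, $M_{a|x}\ge 0$ and $\sum_a M_{a|x}=\mathbb I$ for every $x$), such that $$P(a|x,t_j)=\operatorname{tr}\left(e^{-iHt_j}\rho\, e^{iHt_j}M_{a|x}\right)\quad\text{for all } a,x,j.$$ Let $E^+,\epsilon\in\mathbb{R}$ and $\vec E=(E_0,\dots,E_{m-1})$ with $0\le E_k<E^+$ for all $k$. Let $S(\vec E;E^+,\epsilon,\vec t)$ be the set of datasets that have a quantum realization with $\operatorname{spec}(H)\cap[0,E^+)=\{E_0,\dots,E_{m-1}\}$ and $\operatorname{tr}\left(\rho\,\Pi_H([E^+,\infty))\right)\le\epsilon$,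 where $\Pi_H$ is the spectral measure of $H$; the second condition says that the energy distribution of $\rho$ has weight at most $\epsilon$ on $[E^+,\infty)$. For $E'\in\mathbb{R}\cup\{-\infty\}$ let $G(E',\vec t)$ be the closure of the cone of $N\times N$ complex matrices $\gamma$ of the form $$\gamma_{jk}=\int_{[E',\infty)}e^{-iE(t_k-t_j)}\,d\mu(E),\qquad j,k=1,\dots,N,$$ with $\mu$ a finite positive Borel measure on $\mathbb{R}$ (for $E'=-\infty$ the integral is over all of $\mathbb{R}$). The set of *decay matrices* is $G(\vec t):=G(-\infty,\vec t)$. Let $|0\rangle,\dots,|m+N-1\rangle$ be the standard basis of $\mathbb{C}^{m}\oplus\mathbb{C}^{N}$ and put $$|\tilde\psi_j\rangle:=\sum_{k=0}^{m-1}e^{-iE_kt_j}|k\rangle+|m+j-1\rangle,\qquad j=1,\dots,N.$$ Then the following hold. (1) A dataset $P$ belongs to the closure $\overline{S(\vec E;E^+,\epsilon,\vec t)}$ if and only if there exist a probability distribution $(p_0,\dots,p_m)$, a matrix $\gamma\in G(\vec t)$ and $(m+N)\times(m+N)$ complex matrices $\tilde M_{a|x}$ such that $$p_m\le\epsilon,\qquad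 \tilde M_{a|x}\ge 0\ \ \text{for all } a,x,\qquad \sum_a\tilde M_{a|x}=\begin{pmatrix}\operatorname{diag}(p_0,\dots,p_{m-1})&0\\0&\gamma\end{pmatrix}\ \ \text{for all } x,$$ $$P(a|x,t_j)=\langle\tilde\psi_j|\tilde M_{a|x}|\tilde\psi_j\rangle\quad\text{for all } a,x,j.$$ (2) $G(E',\vec t)=G(-\infty,\vec t)$ for every $E'\in\mathbb{R}$. -/

import Mathlib

open scoped InnerProductSpace Matrix ComplexOrder

noncomputable section

/-- A projection-valued measure on the Borel sets of `ℝ`, acting on a complex Hilbert space;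
countable additivity is meant in the strong operator topology. -/
structure ProjValuedMeasure (𝓗 : Type) [NormedAddCommGroup 𝓗] [InnerProductSpace ℂ 𝓗]
    [CompleteSpace 𝓗] where
  /-- the projection attached to a (Borel) set -/
  proj : Set ℝ → (𝓗 →L[ℂ] 𝓗)
  isStarProjection : ∀ B, MeasurableSet B → IsStarProjection (proj B)
  proj_univ : proj Set.univ = 1
  proj_inter : ∀ B C, MeasurableSet B → MeasurableSet C → proj (B ∩ C) = proj B * proj C
  hasSum_iUnion : ∀ f : ℕ → Set ℝ, (∀ n, MeasurableSet (f n)) →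
    Pairwise (Function.onFun Disjoint f) →
    ∀ ψ : 𝓗, HasSum (fun n => proj (f n) ψ) (proj (⋃ n, f n) ψ)

namespace ProjValuedMeasure

variable {𝓗 : Type} [NormedAddCommGroup 𝓗] [InnerProductSpace ℂ 𝓗] [CompleteSpace 𝓗]

theorem proj_empty (Q : ProjValuedMeasure 𝓗) : Q.proj ∅ = 0 := by
  ext ψ
  have h := Q.hasSum_iUnion (fun _ => ∅) (fun _ => MeasurableSet.empty)
    (fun i j _ => by simp [Function.onFun]) ψ
  simpa using tendsto_const_nhds_iff.mp h.summable.tendsto_atTop_zero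

theorem re_inner_proj_nonneg (Q : ProjValuedMeasure 𝓗) (ψ : 𝓗) {B : Set ℝ}
    (hB : MeasurableSet B) : 0 ≤ (⟪ψ, Q.proj B ψ⟫_ℂ).re := by
  have h := Q.isStarProjection B hB
  have h1 : Q.proj B ψ = Q.proj B (Q.proj B ψ) := by
    conv_lhs => rw [← h.isIdempotentElem.eq]
    rfl
  have h2 : ContinuousLinearMap.adjoint (Q.proj B) = Q.proj B := h.isSelfAdjoint
  rw [h1]
  nth_rewrite 1 [← h2]
  rw [ContinuousLinearMap.adjoint_inner_right]
  exact inner_self_nonneg (𝕜 := ℂ)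

/-- The scalar spectral measure `B ↦ ⟨ψ, Q(B) ψ⟩` of a vector. -/
def scalarMeasure (Q : ProjValuedMeasure 𝓗) (ψ : 𝓗) : MeasureTheory.Measure ℝ :=
  MeasureTheory.Measure.ofMeasurable
    (fun B _ => ENNReal.ofReal (⟪ψ, Q.proj B ψ⟫_ℂ).re)
    (by simp [Q.proj_empty])
    (by
      intro f hf hd
      have h1 := (Q.hasSum_iUnion f hf hd ψ).mapL (innerSL ℂ ψ)
      have h2 := h1.mapL Complex.reCLM
      have h3 : HasSum (fun n => (⟪ψ, Q.proj (f n) ψ⟫_ℂ).re)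
          (⟪ψ, Q.proj (⋃ n, f n) ψ⟫_ℂ).re := by simpa using h2
      rw [← h3.tsum_eq]
      exact ENNReal.ofReal_tsum_of_nonneg
        (fun n => Q.re_inner_proj_nonneg ψ (hf n)) h3.summable)

/-- `T` is the bounded operator `∫ f dQ`. By polarization the quadratic form determines `T`. -/
def IsIntegral (Q : ProjValuedMeasure 𝓗) (f : ℝ → ℂ) (T : 𝓗 →L[ℂ] 𝓗) : Prop :=
  ∀ ψ : 𝓗, ⟪ψ, T ψ⟫_ℂ = ∫ E, f E ∂(Q.scalarMeasure ψ)

/-- `Q` is the spectral measure of the possibly unbounded operator `H`, that is `H = ∫ E dQ(E)`,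
with domain the vectors whose scalar spectral measure has a finite second moment. -/
def IsSpectralMeasureOf (Q : ProjValuedMeasure 𝓗) (H : 𝓗 →ₗ.[ℂ] 𝓗) : Prop :=
  (∀ ψ : 𝓗, ψ ∈ H.domain ↔
      MeasureTheory.Integrable (fun E : ℝ => E ^ 2) (Q.scalarMeasure ψ)) ∧
    ∀ ψ : H.domain, ⟪(ψ : 𝓗), H ψ⟫_ℂ = ((∫ E, E ∂(Q.scalarMeasure (ψ : 𝓗)) : ℝ) : ℂ)

end ProjValuedMeasure

section Operators

variable {𝓗 : Type} [NormedAddCommGroup 𝓗] [InnerProductSpace ℂ 𝓗] [CompleteSpace 𝓗]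

/-- `c` is in the resolvent set of `H`: the operator `H - c` has a bounded two-sided inverse. -/
def InResolventSet (H : 𝓗 →ₗ.[ℂ] 𝓗) (c : ℂ) : Prop :=
  ∃ R : 𝓗 →L[ℂ] 𝓗,
    (∀ y : 𝓗, ∃ h : R y ∈ H.domain, H ⟨R y, h⟩ - c • R y = y) ∧
    ∀ x : H.domain, R (H x - c • (x : 𝓗)) = x

/-- The real spectrum (which is the whole spectrum when `H` is self-adjoint). -/
def realSpectrum (H : 𝓗 →ₗ.[ℂ] 𝓗) : Set ℝ := {E | ¬ InResolventSet H (E : ℂ)}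

/-- `T` is trace class with trace `z`: the diagonal sums converge to `z` in every Hilbert basis. -/
def HasTrace (T : 𝓗 →L[ℂ] 𝓗) (z : ℂ) : Prop :=
  ∀ (ι : Type) (b : HilbertBasis ι ℂ 𝓗), HasSum (fun i => ⟪b i, T (b i)⟫_ℂ) z

end Operators

/-- A quantum realization `(𝓗, ρ, H, M)` with `A` outcomes and `X` measurement settings. The
Hamiltonian `H ≥ 0` is a possibly unbounded self-adjoint operator; it is accompanied by its
spectral measure and its evolution operators `U t = exp (-i H t)`, both determined by `H`. -/
structure Realization (A X : ℕ) where
  𝓗 : Type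
  [normedAddCommGroup : NormedAddCommGroup 𝓗]
  [innerProductSpace : InnerProductSpace ℂ 𝓗]
  [completeSpace : CompleteSpace 𝓗]
  /-- the initial state, a density operator -/
  ρ : 𝓗 →L[ℂ] 𝓗
  ρ_pos : ρ.IsPositive
  ρ_trace : HasTrace ρ 1
  /-- the Hamiltonian -/
  H : 𝓗 →ₗ.[ℂ] 𝓗
  H_selfAdjoint : IsSelfAdjoint H
  H_nonneg : ∀ ψ : H.domain, 0 ≤ (⟪(ψ : 𝓗), H ψ⟫_ℂ).re
  /-- the spectral measure of the Hamiltonian -/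
  Q : ProjValuedMeasure 𝓗
  Q_spec : Q.IsSpectralMeasureOf H
  /-- the evolution operators -/
  U : ℝ → (𝓗 →L[ℂ] 𝓗)
  U_spec : ∀ t : ℝ, Q.IsIntegral (fun E => Complex.exp (-Complex.I * E * t)) (U t)
  /-- the measurements: `M a x` is the effect of outcome `a` in setting `x` -/
  M : Fin A → Fin X → (𝓗 →L[ℂ] 𝓗)
  M_pos : ∀ a x, (M a x).IsPositive
  M_sum : ∀ x, ∑ a, M a x = 1

attribute [instance] Realization.normedAddCommGroup Realization.innerProductSpace
  Realization.completeSpace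

/-- The realization yields `P(a|x,t) = p`, that is `tr (e^{-iHt} ρ e^{iHt} M_{a|x}) = p`. -/
def Realization.Yields {A X : ℕ} (R : Realization A X) (a : Fin A) (x : Fin X) (t p : ℝ) : Prop :=
  HasTrace (R.U t * R.ρ * R.U (-t) * R.M a x) (p : ℂ)

/-- The energy distribution of the state gives weight at most `ε` to the Borel set `B`. -/
def Realization.EnergyWeightLE {A X : ℕ} (R : Realization A X) (B : Set ℝ) (ε : ℝ) : Prop :=
  ∃ w : ℝ, HasTrace (R.ρ * R.Q.proj B) (w : ℂ) ∧ w ≤ ε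

/-- A dataset: for each setting and each time index, a probability distribution over outcomes. -/
def IsDataset {A X N : ℕ} (P : Fin A → Fin X → Fin N → ℝ) : Prop :=
  (∀ a x j, 0 ≤ P a x j) ∧ ∀ x j, ∑ a, P a x j = 1

/-- The set `S(E; Eplus, ε, t)` of datasets, with `P a x j` standing for `P(a|x,t_j)`. -/
def softSpectralDatasets (A X : ℕ) {N m : ℕ} (E : Fin m → ℝ) (Eplus ε : ℝ) (t : Fin N → ℝ) :
    Set (Fin A → Fin X → Fin N → ℝ) :=
  {P | ∃ R : Realization A X,
    realSpectrum R.H ∩ Set.Ico 0 Eplus = Set.range E ∧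
    R.EnergyWeightLE (Set.Ici Eplus) ε ∧
    ∀ a x j, R.Yields a x (t j) (P a x j)}

/-- The closure of the cone of matrices `γ_{jk} = ∫_I exp (-i E (t_k - t_j)) dμ(E)`, where `μ` is a
finite positive Borel measure. -/
def decayMatricesOn {N : ℕ} (I : Set ℝ) (t : Fin N → ℝ) : Set (Matrix (Fin N) (Fin N) ℂ) :=
  closure {γ | ∃ μ : MeasureTheory.Measure ℝ, MeasureTheory.IsFiniteMeasure μ ∧
    ∀ j k, γ j k = ∫ E in I, Complex.exp (-Complex.I * E * (t k - t j)) ∂μ}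

/-- The set `G(t)` of decay matrices. -/
def decayMatrices {N : ℕ} (t : Fin N → ℝ) : Set (Matrix (Fin N) (Fin N) ℂ) :=
  decayMatricesOn Set.univ t

/-- The vector `∑_k exp (-i E_k t_j) |k⟩ + |m + j⟩` of `ℂ^m ⊕ ℂ^N`. -/
def probeVector {N m : ℕ} (E : Fin m → ℝ) (t : Fin N → ℝ) (j : Fin N) : Fin m ⊕ Fin N → ℂ :=
  Sum.elim (fun k => Complex.exp (-Complex.I * E k * t j)) (Pi.single j 1)

end

/-! A realization with low-energy spectrum `E 0, …, E (m - 1)` evolves by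
`e^{-iHt} = ∑ k, e^{-i E k t} Π k + e^{-iHt} Π [Eplus, ∞)`. Compressing an effect to the operators
`Π k` and `e^{-iH t j} Π [Eplus, ∞)`, with respect to the Hilbert-Schmidt inner product weighted by
the state, turns it into a positive matrix whose value at the `j`-th probe vector is the
probability at time `t j`. The matrices of a measurement sum to `diag p ⊕ γ`, where `γ` is the decay
matrix of the energy distribution on `[Eplus, ∞)`. Such triples of `p`, `γ` and positive matrices
form a compact set, so limits of datasets have them as well.

Conversely, the phases `e^{-i e (t k - t j)}` at any energy `e` recur approximately at arbitrarily
high energies, because powers of a point of a torus accumulate at the identity. So a decay matrix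
with constant diagonal is a limit of convex combinations of phase matrices with high energies. Such
a combination is realized by a pure state with a diagonal Hamiltonian: writing `diag p ⊕ γ = Wᴴ W`,
every decomposition of it into positive matrices is `a ↦ Wᴴ F a W` for a measurement `F`. Finally,
moving `γ` moves a decomposition of `diag p ⊕ γ` continuously, through the square root. -/

noncomputable section

section Phase

/-- The phase factor `exp (-i e s)` acquired by energy `e` in time `s`. -/
def phase (e s : ℝ) : ℂ :=
  Complex.exp (-Complex.I * e * s)

theorem phase_eq_circleExp (e s : ℝ) : phase e s = Circle.exp (-(e * s)) := by
  rw [phase, Circle.coe_exp]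
  push_cast
  ring_nf

@[simp]
theorem norm_phase (e s : ℝ) : ‖phase e s‖ = 1 := by
  rw [phase_eq_circleExp, Circle.norm_coe]

@[simp]
theorem phase_zero_right (e : ℝ) : phase e 0 = 1 := by
  simp [phase]

theorem phase_add_left (e e' s : ℝ) : phase (e + e') s = phase e s * phase e' s := by
  simp only [phase, ← Complex.exp_add]
  push_cast
  ring_nf

theorem phase_add_right (e s s' : ℝ) : phase e (s + s') = phase e s * phase e s' := by
  simp only [phase, ← Complex.exp_add]
  push_cast
  ring_nf

theorem star_phase (e s : ℝ) : star (phase e s) = phase e (-s) := by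
  simp [phase, ← Complex.exp_conj]

theorem phase_natCast (n : ℕ) (s : ℝ) : phase n s = ((Circle.exp (-s) ^ n : Circle) : ℂ) := by
  rw [phase_eq_circleExp, ← mul_neg, Circle.exp_natCast_mul]

@[fun_prop]
theorem continuous_phase (s : ℝ) : Continuous fun e => phase e s := by
  unfold phase
  fun_prop

end Phase

section DecayCone

open MeasureTheory Filter Topology

open scoped NNReal Pointwise

variable {ι : Type*}

/-- The decay matrix of the point mass at energy `e`. -/
def phaseMatrix (t : ι → ℝ) (e : ℝ) : Matrix ι ι ℂ :=
  .of fun j k => phase e (t k - t j)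

/-- The cone of the decay matrices of finitely supported measures on `I`. -/
def phaseCone (I : Set ℝ) (t : ι → ℝ) : PointedCone ℝ (Matrix ι ι ℂ) :=
  PointedCone.hull ℝ (phaseMatrix t '' I)

@[simp]
theorem phaseMatrix_apply (t : ι → ℝ) (e : ℝ) (j k : ι) :
    phaseMatrix t e j k = phase e (t k - t j) :=
  rfl

theorem phaseMatrix_mem_phaseCone {I : Set ℝ} {t : ι → ℝ} {e : ℝ} (he : e ∈ I) :
    phaseMatrix t e ∈ phaseCone I t :=
  Submodule.subset_span ⟨e, he, rfl⟩

theorem mem_phaseCone {I : Set ℝ} {t : ι → ℝ} {γ : Matrix ι ι ℂ} :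
    γ ∈ phaseCone I t ↔ ∃ (n : ℕ) (c : Fin n → ℝ≥0) (e : Fin n → ℝ), (∀ i, e i ∈ I) ∧
      γ = ∑ i, c i • phaseMatrix t (e i) := by
  constructor
  · intro hγ
    obtain ⟨n, c, g, rfl⟩ := Submodule.mem_span_set'.1 hγ
    choose e he hg using fun i => (g i).2
    exact ⟨n, c, e, he, Finset.sum_congr rfl fun i _ => by rw [hg]; rfl⟩
  · rintro ⟨n, c, e, he, rfl⟩
    exact sum_mem fun i _ => Submodule.smul_mem _ (c i) (phaseMatrix_mem_phaseCone (he i))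

theorem norm_apply_le_re_apply_self_of_mem_closure_phaseCone {I : Set ℝ} {t : ι → ℝ}
    {γ : Matrix ι ι ℂ} (hγ : γ ∈ closure (phaseCone I t : Set (Matrix ι ι ℂ))) (j k : ι) :
    ‖γ j k‖ ≤ (γ j j).re := by
  have hclosed : IsClosed {γ : Matrix ι ι ℂ | ‖γ j k‖ ≤ (γ j j).re} :=
    isClosed_le (by fun_prop) (by fun_prop)
  refine closure_minimal (fun γ hγ => ?_) hclosed hγ
  obtain ⟨n, c, e, -, rfl⟩ := mem_phaseCone.1 hγ
  calc ‖(∑ i, c i • phaseMatrix t (e i)) j k‖ ≤ ∑ i, ‖(c i • phaseMatrix t (e i)) j k‖ := by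
        simpa only [Matrix.sum_apply] using norm_sum_le _ _
    _ = ((∑ i, c i • phaseMatrix t (e i)) j j).re := by
        simp [Matrix.sum_apply, NNReal.smul_def]

theorem phaseMatrix_mem_closure_image_Ici (t : ι → ℝ) (e e' : ℝ) :
    phaseMatrix t e ∈ closure (phaseMatrix t '' Set.Ici e') := by
  let u : ι → ι → Circle := fun j k => Circle.exp (-(t k - t j))
  let f : (ι → ι → Circle) → Matrix ι ι ℂ := fun z => .of fun j k => phaseMatrix t e j k * z j k
  have hf : Continuous f := by
    refine continuous_matrix fun j k => ?_
    simp only [f, Matrix.of_apply]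
    fun_prop
  have hfu (n : ℕ) : f (u ^ n) = phaseMatrix t (e + n) := by
    ext j k
    simp [f, u, phase_add_left, phase_natCast]
  have hf1 : f 1 = phaseMatrix t e := by
    ext j k
    simp [f]
  -- The powers of a point of a compact group accumulate at the identity.
  have hcluster : MapClusterPt (f 1) atTop fun n => f (u ^ n) :=
    (mapClusterPt_one_atTop_pow u).continuousAt_comp hf.continuousAt
  obtain ⟨n₀, hn₀⟩ := exists_nat_ge (e' - e)
  rw [← hf1]
  refine closure_mono ?_ (mapClusterPt_atTop_iff_forall_mem_closure.1 hcluster n₀)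
  rintro _ ⟨n, hn, rfl⟩
  have hn' : (n₀ : ℝ) ≤ n := Nat.cast_le.2 hn
  exact ⟨e + n, by simp only [Set.mem_Ici]; linarith, (hfu n).symm⟩

theorem closure_phaseCone_Ici (t : ι → ℝ) (e' : ℝ) :
    closure (phaseCone (Set.Ici e') t : Set (Matrix ι ι ℂ)) =
      closure (phaseCone Set.univ t : Set (Matrix ι ι ℂ)) := by
  apply Set.Subset.antisymm
  · exact closure_mono (Submodule.span_mono (Set.image_mono (Set.subset_univ _)))
  · have hle : phaseCone Set.univ t ≤ (phaseCone (Set.Ici e') t).topologicalClosure := by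
      refine Submodule.span_le.2 ?_
      rintro _ ⟨e, -, rfl⟩
      exact closure_mono Submodule.subset_span (phaseMatrix_mem_closure_image_Ici t e e')
    exact closure_minimal hle isClosed_closure

theorem inv_smul_mem_convexHull_of_mem_phaseCone {I : Set ℝ} {t : ι → ℝ} {γ : Matrix ι ι ℂ}
    (hγ : γ ∈ phaseCone I t) {j : ι} (hj : 0 < (γ j j).re) :
    (γ j j).re⁻¹ • γ ∈ convexHull ℝ (phaseMatrix t '' I) := by
  obtain ⟨n, c, e, he, rfl⟩ := mem_phaseCone.1 hγ
  have htrace : ((∑ i, c i • phaseMatrix t (e i)) j j).re = ∑ i, (c i : ℝ) := by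
    simp [Matrix.sum_apply, NNReal.smul_def]
  rw [htrace] at hj ⊢
  exact Finset.univ.centerMass_mem_convexHull (fun i _ => (c i).2) hj
    fun i _ => Set.mem_image_of_mem _ (he i)

theorem mem_closure_smul_convexHull_phaseMatrix {I : Set ℝ} (hI : I.Nonempty) {t : ι → ℝ}
    {γ : Matrix ι ι ℂ} (hγ : γ ∈ closure (phaseCone I t : Set (Matrix ι ι ℂ))) {c : ℝ}
    (hc : 0 ≤ c) (hdiag : ∀ j, γ j j = c) :
    γ ∈ closure (c • convexHull ℝ (phaseMatrix t '' I)) := by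
  have hne : (convexHull ℝ (phaseMatrix t '' I)).Nonempty := (hI.image _).convexHull
  rcases isEmpty_or_nonempty ι with hι | ⟨⟨j⟩⟩
  · obtain ⟨g, hg⟩ := hne.smul_set (a := c)
    exact Subsingleton.elim g γ ▸ subset_closure hg
  rcases hc.eq_or_lt with rfl | hc
  · have hγ0 : γ = 0 := by
      ext j k
      simpa [hdiag] using norm_apply_le_re_apply_self_of_mem_closure_phaseCone hγ j k
    rw [Set.zero_smul_set hne, hγ0]
    exact subset_closure rfl
  · have hre : (γ j j).re = c := by simp [hdiag]
    have hcont : Continuous fun g : Matrix ι ι ℂ => (g j j).re := by fun_prop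
    have hpos : ∀ᶠ g : Matrix ι ι ℂ in 𝓝 γ, 0 < (g j j).re :=
      hcont.continuousAt.eventually_const_lt (hc.trans_eq hre.symm)
    have hlim : Tendsto (fun g : Matrix ι ι ℂ => c • (g j j).re⁻¹ • g) (𝓝 γ)
        (𝓝 (c • (γ j j).re⁻¹ • γ)) :=
      ((hcont.continuousAt.inv₀ (by simpa [hre] using hc.ne')).smul continuousAt_id).const_smul c
    rw [hre, smul_inv_smul₀ hc.ne'] at hlim
    refine mem_closure_iff_frequently.2 (hlim.frequently ?_)
    refine ((mem_closure_iff_frequently.1 hγ).and_eventually hpos).mono fun g hg => ?_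
    exact Set.smul_mem_smul_set (inv_smul_mem_convexHull_of_mem_phaseCone hg.1 hg.2)

theorem mem_closure_phaseCone_of_forall_eq_setIntegral [Finite ι] {I : Set ℝ}
    (hI : MeasurableSet I) {t : ι → ℝ} {μ : Measure ℝ} [IsFiniteMeasure μ] {γ : Matrix ι ι ℂ}
    (hγ : ∀ j k, γ j k = ∫ e in I, phase e (t k - t j) ∂μ) :
    γ ∈ closure (phaseCone I t : Set (Matrix ι ι ℂ)) := by
  have := Fintype.ofFinite ι
  let f : ℝ → ι → ι → ℂ := fun e j k => phase e (t k - t j)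
  let K : PointedCone ℝ (ι → ι → ℂ) := phaseCone I t
  have hf : Integrable f (μ.restrict I) := by
    have hcont : Continuous f := by fun_prop
    refine .of_bound hcont.aestronglyMeasurable 1 (.of_forall fun e => ?_)
    simp [f, pi_norm_le_iff_of_nonneg]
  have hγf : γ = ∫ e in I, f e ∂μ := by
    ext j k
    rw [eval_integral fun j => hf.eval j, eval_integral fun k => (hf.eval j).eval k]
    exact hγ j k
  rw [hγf]
  rcases eq_zero_or_neZero (μ.restrict I) with h0 | h0
  · rw [h0, integral_zero_measure]
    exact subset_closure (zero_mem K)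
  · have haverage : ⨍ e in I, f e ∂μ ∈ K.closure := by
      refine K.toConvexCone.convex.closure.average_mem isClosed_closure ?_ hf
      filter_upwards [ae_restrict_mem hI] with e he
      exact subset_closure (phaseMatrix_mem_phaseCone he)
    rw [← measure_smul_average]
    exact K.closure.smul_mem measureReal_nonneg haverage

theorem exists_measure_of_mem_phaseCone {I : Set ℝ} (hI : MeasurableSet I) {t : ι → ℝ}
    {γ : Matrix ι ι ℂ} (hγ : γ ∈ phaseCone I t) :
    ∃ μ : Measure ℝ, IsFiniteMeasure μ ∧ ∀ j k, γ j k = ∫ e in I, phase e (t k - t j) ∂μ := by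
  obtain ⟨n, c, e, he, rfl⟩ := mem_phaseCone.1 hγ
  have hdirac (i : Fin n) : (Measure.dirac (e i)).restrict I = Measure.dirac (e i) := by
    classical
    rw [restrict_dirac' hI, if_pos (he i)]
  have hrestrict : (∑ i, c i • Measure.dirac (e i)).restrict I =
      ∑ i, c i • Measure.dirac (e i) := by
    rw [← Measure.restrictₗ_apply, map_sum]
    simp [Measure.restrictₗ_apply, hdirac]
  have hintegrable (s : ℝ) (i : Fin n) :
      Integrable (fun e => phase e s) (c i • Measure.dirac (e i)) :=
    .of_bound (continuous_phase s).aestronglyMeasurable 1 (.of_forall fun e => (norm_phase e s).le)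
  refine ⟨∑ i, c i • Measure.dirac (e i), inferInstance, fun j k => ?_⟩
  rw [hrestrict, integral_finsetSum_measure fun i _ => hintegrable _ i]
  simp [Matrix.sum_apply, integral_smul_nnreal_measure]

theorem decayMatricesOn_eq_closure_phaseCone {N : ℕ} {I : Set ℝ} (hI : MeasurableSet I)
    (t : Fin N → ℝ) :
    decayMatricesOn I t = closure (phaseCone I t : Set (Matrix (Fin N) (Fin N) ℂ)) := by
  refine (closure_minimal ?_ isClosed_closure).antisymm (closure_mono ?_)
  · rintro γ ⟨μ, hμ, hγ⟩
    exact mem_closure_phaseCone_of_forall_eq_setIntegral (μ := μ) hI (by simpa [phase] using hγ)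
  · intro γ hγ
    obtain ⟨μ, hμ, hγμ⟩ := exists_measure_of_mem_phaseCone hI hγ
    exact ⟨μ, hμ, by simpa [phase] using hγμ⟩

theorem decayMatricesOn_Ici {N : ℕ} (t : Fin N → ℝ) (e : ℝ) :
    decayMatricesOn (Set.Ici e) t = decayMatrices t := by
  rw [decayMatrices, decayMatricesOn_eq_closure_phaseCone measurableSet_Ici,
    decayMatricesOn_eq_closure_phaseCone .univ, closure_phaseCone_Ici]

end DecayCone

section PositiveMatrices

open Matrix

open scoped MatrixOrder Matrix.Norms.L2Operator

variable {α m n : Type*}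

theorem norm_apply_le_of_posSemidef [Finite n] {M : Matrix n n ℂ} (hM : M.PosSemidef) (i j : n) :
    ‖M i j‖ ≤ ((M i i).re + (M j j).re) / 2 := by
  classical
  have := Fintype.ofFinite n
  obtain ⟨B, rfl⟩ := CStarAlgebra.nonneg_iff_eq_star_mul_self.1 hM.nonneg
  have hdiag (k : n) : ((star B * B) k k).re = ∑ l, ‖B l k‖ ^ 2 := by
    simp [mul_apply, star_eq_conjTranspose, ← Complex.normSq_eq_conj_mul_self,
      Complex.normSq_eq_norm_sq, -Complex.ofReal_pow]
  rw [hdiag, hdiag, mul_apply, ← Finset.sum_add_distrib, Finset.sum_div]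
  refine norm_sum_le_of_le _ fun l _ => ?_
  rw [star_apply, norm_mul, norm_star]
  linarith [two_mul_le_add_sq ‖B l i‖ ‖B l j‖]

theorem mul_eq_zero_of_le_conjTranspose_mul_self [Fintype m] [Fintype n]
    {M : Matrix n n ℂ} (hM : 0 ≤ M) {W : Matrix m n ℂ} (hMW : M ≤ Wᴴ * W)
    {Y : Matrix n n ℂ} (hY : W * Y = 0) : M * Y = 0 := by
  classical
  obtain ⟨B, rfl⟩ := CStarAlgebra.nonneg_iff_eq_star_mul_self.1 hM
  have hle : (B * Y)ᴴ * (B * Y) ≤ (W * Y)ᴴ * (W * Y) := by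
    simpa only [conjTranspose_mul, star_eq_conjTranspose, Matrix.mul_assoc]
      using star_left_conjugate_le_conjugate hMW Y
  rw [hY, Matrix.mul_zero] at hle
  have hBY : B * Y = 0 :=
    conjTranspose_mul_self_eq_zero.1 (hle.antisymm (posSemidef_conjTranspose_mul_self _).nonneg)
  rw [Matrix.mul_assoc, hBY, Matrix.mul_zero]

theorem exists_isHermitian_mul_mul_cancel [Fintype n] {G : Matrix n n ℂ}
    (hG : G.IsHermitian) : ∃ K : Matrix n n ℂ, K.IsHermitian ∧ G * K * G = G := by
  classical
  have hsa : IsSelfAdjoint G := hG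
  have hcont (f : ℝ → ℝ) : ContinuousOn f (spectrum ℝ G) := G.finite_real_spectrum.continuousOn f
  refine ⟨cfc (fun x : ℝ => x⁻¹) G, cfc_predicate _ G, ?_⟩
  nth_rewrite 1 3 [← cfc_id' ℝ G]
  rw [← cfc_mul _ _ G (hcont _) (hcont _), ← cfc_mul _ _ G (hcont _) (hcont _)]
  simp only [mul_inv_mul_cancel, cfc_id' ℝ G]

theorem exists_mul_isHermitian_mul_mul_cancel [Fintype m] [Fintype n] (W : Matrix m n ℂ) :
    ∃ K : Matrix n m ℂ, (W * K).IsHermitian ∧ W * K * W = W := by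
  classical
  obtain ⟨G, hG, hcancel⟩ :=
    exists_isHermitian_mul_mul_cancel (isHermitian_conjTranspose_mul_self W)
  refine ⟨G * Wᴴ, ?_, ?_⟩
  · simpa only [Matrix.mul_assoc] using isHermitian_mul_mul_conjTranspose W hG
  · have hgram : Wᴴ * W * (G * (Wᴴ * W) - 1) = 0 := by
      rw [Matrix.mul_sub, Matrix.mul_one, ← Matrix.mul_assoc, hcancel, sub_self]
    have hW := (conjTranspose_mul_self_mul_eq_zero W _).1 hgram
    rw [Matrix.mul_sub, Matrix.mul_one, sub_eq_zero] at hW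
    simpa only [Matrix.mul_assoc] using hW

theorem exists_povm_of_sum_eq_conjTranspose_mul_self [Fintype α] [Nonempty α] [Fintype m]
    [DecidableEq m] [Finite n] {M : α → Matrix n n ℂ} (hM : ∀ a, (M a).PosSemidef)
    {W : Matrix m n ℂ} (hsum : ∑ a, M a = Wᴴ * W) :
    ∃ F : α → Matrix m m ℂ, (∀ a, (F a).PosSemidef) ∧ ∑ a, F a = 1 ∧
      ∀ a, Wᴴ * F a * W = M a := by
  classical
  have := Fintype.ofFinite n
  obtain ⟨K, hWK, hW⟩ := exists_mul_isHermitian_mul_mul_cancel W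
  have hKW : Kᴴ * Wᴴ = W * K := by rw [← conjTranspose_mul, hWK.eq]
  have hMK (a : α) : M a * (K * W) = M a := by
    have hle : M a ≤ Wᴴ * W :=
      hsum ▸ Finset.single_le_sum (fun b _ => (hM b).nonneg) (Finset.mem_univ a)
    have hzero : M a * (K * W - 1) = 0 :=
      mul_eq_zero_of_le_conjTranspose_mul_self (hM a).nonneg hle (by
        rw [Matrix.mul_sub, ← Matrix.mul_assoc, hW, Matrix.mul_one, sub_self])
    rwa [Matrix.mul_sub, Matrix.mul_one, sub_eq_zero] at hzero
  have hKM (a : α) : (K * W)ᴴ * M a = M a := by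
    simpa only [conjTranspose_mul, (hM a).isHermitian.eq] using congrArg conjTranspose (hMK a)
  have hproj : W * K * (W * K) = W * K := by rw [← Matrix.mul_assoc, hW]
  obtain ⟨a₀⟩ := ‹Nonempty α›
  -- The outcome `a₀` also receives the projection onto the complement of the range of `W`.
  refine ⟨fun a => Kᴴ * M a * K + if a = a₀ then 1 - W * K else 0, fun a => ?_, ?_, fun a => ?_⟩
  · refine ((hM a).conjTranspose_mul_mul_same K).add ?_
    split_ifs
    · exact nonneg_iff_posSemidef.1 (IsStarProjection.mk hproj hWK).one_sub.nonneg
    · exact .zero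
  · rw [Finset.sum_add_distrib, ← Matrix.sum_mul, ← Matrix.mul_sum, hsum, ← Matrix.mul_assoc, hKW,
      Matrix.mul_assoc, hproj]
    simp
  · have hcompl : (if a = a₀ then 1 - W * K else 0) * W = 0 := by
      split_ifs
      · rw [Matrix.sub_mul, hW, Matrix.one_mul, sub_self]
      · exact Matrix.zero_mul W
    calc Wᴴ * (Kᴴ * M a * K + if a = a₀ then 1 - W * K else 0) * W
        = (K * W)ᴴ * M a * (K * W) + Wᴴ * ((if a = a₀ then 1 - W * K else 0) * W) := by
          simp only [Matrix.mul_add, Matrix.add_mul, conjTranspose_mul, Matrix.mul_assoc]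
      _ = M a := by rw [hcompl, Matrix.mul_zero, add_zero, hKM, hMK]

theorem exists_continuousOn_decomposition [Fintype α] [Nonempty α] [Finite n]
    {M : α → Matrix n n ℂ} (hM : ∀ a, (M a).PosSemidef) :
    ∃ Φ : Matrix n n ℂ → α → Matrix n n ℂ, ContinuousOn Φ {D | D.PosSemidef} ∧
      Φ (∑ a, M a) = M ∧
      ∀ D : Matrix n n ℂ, D.PosSemidef → (∀ a, (Φ D a).PosSemidef) ∧ ∑ a, Φ D a = D := by
  classical
  have := Fintype.ofFinite n
  let S : Matrix n n ℂ → Matrix n n ℂ := CFC.sqrt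
  have hcont : ContinuousOn S {D | D.PosSemidef} := by
    have h : ContinuousOn S {D | 0 ≤ D} := CFC.continuousOn_sqrt
    simpa only [nonneg_iff_posSemidef] using h
  have hSS (D : Matrix n n ℂ) (hD : D.PosSemidef) : (S D)ᴴ * S D = D := by
    rw [(nonneg_iff_posSemidef.1 (CFC.sqrt_nonneg D)).isHermitian.eq]
    exact CFC.sqrt_mul_sqrt_self D hD.nonneg
  obtain ⟨F, hF, hF1, hFM⟩ := exists_povm_of_sum_eq_conjTranspose_mul_self hM
    (hSS (∑ a, M a) (posSemidef_sum _ fun a _ => hM a)).symm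
  refine ⟨fun D a => (S D)ᴴ * F a * S D, ?_, funext hFM, fun D hD => ⟨fun a => ?_, ?_⟩⟩
  · rw [continuousOn_pi]
    exact fun a => (hcont.star.mul continuousOn_const).mul hcont
  · exact (hF a).conjTranspose_mul_mul_same _
  · rw [← Matrix.sum_mul, ← Matrix.mul_sum, hF1, Matrix.mul_one, hSS D hD]

theorem isClosed_setOf_posSemidef [Finite n] :
    IsClosed {M : Matrix n n ℂ | M.PosSemidef} := by
  classical
  have := Fintype.ofFinite n
  have h : IsClosed {M : Matrix n n ℂ | 0 ≤ M} := CStarAlgebra.isClosed_nonneg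
  simpa only [nonneg_iff_posSemidef] using h

end PositiveMatrices

section BoundedMeasurable

open MeasureTheory Filter Topology

/-- Bounded measurable functions, those whose integral with respect to a projection-valued measure
is a bounded operator. -/
def IsBddMeasurable (f : ℝ → ℂ) : Prop :=
  Measurable f ∧ ∃ C, ∀ x, ‖f x‖ ≤ C

namespace IsBddMeasurable

variable {f g : ℝ → ℂ}

theorem integrable (hf : IsBddMeasurable f) (μ : Measure ℝ) [IsFiniteMeasure μ] :
    Integrable f μ := by
  obtain ⟨hmeas, C, hC⟩ := hf
  exact .of_bound hmeas.aestronglyMeasurable C (.of_forall hC)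

theorem indicator_one {B : Set ℝ} (hB : MeasurableSet B) : IsBddMeasurable (B.indicator 1) :=
  ⟨measurable_one.indicator hB, 1, fun x => (norm_indicator_le_norm_self 1 x).trans (by simp)⟩

theorem mul (hf : IsBddMeasurable f) (hg : IsBddMeasurable g) : IsBddMeasurable (f * g) := by
  obtain ⟨hf, C, hC⟩ := hf
  obtain ⟨hg, D, hD⟩ := hg
  exact ⟨hf.mul hg, C * D, fun x => norm_mul_le_of_le (hC x) (hD x)⟩

theorem star (hf : IsBddMeasurable f) : IsBddMeasurable (star f) := by
  obtain ⟨hf, C, hC⟩ := hf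
  exact ⟨continuous_star.measurable.comp hf, C, fun x => (norm_star (f x)).trans_le (hC x)⟩

theorem phase (s : ℝ) : IsBddMeasurable fun e => phase e s :=
  ⟨(continuous_phase s).measurable, 1, fun e => (norm_phase e s).le⟩

theorem simpleFunc (s : SimpleFunc ℝ ℂ) : IsBddMeasurable s :=
  ⟨s.measurable, s.exists_forall_norm_le⟩

theorem exists_tendsto_simpleFunc (hf : IsBddMeasurable f) :
    ∃ (s : ℕ → SimpleFunc ℝ ℂ) (C : ℝ), (∀ n x, ‖s n x‖ ≤ C) ∧
      ∀ x, Tendsto (fun n => s n x) atTop (𝓝 (f x)) := by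
  obtain ⟨hmeas, C, hC⟩ := hf
  have hs := hmeas.stronglyMeasurable
  exact ⟨hs.approxBounded C, C,
    fun n x => hs.norm_approxBounded_le ((norm_nonneg _).trans (hC 0)) n x,
    fun x => hs.tendsto_approxBounded_of_norm_le (hC x)⟩

end IsBddMeasurable

theorem tendsto_integral_of_forall_norm_le {f : ℕ → ℝ → ℂ} {g : ℝ → ℂ} {C : ℝ}
    (hf : ∀ n, Measurable (f n)) (hC : ∀ n x, ‖f n x‖ ≤ C)
    (hlim : ∀ x, Tendsto (fun n => f n x) atTop (𝓝 (g x))) (μ : Measure ℝ) [IsFiniteMeasure μ] :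
    Tendsto (fun n => ∫ x, f n x ∂μ) atTop (𝓝 (∫ x, g x ∂μ)) :=
  tendsto_integral_of_dominated_convergence (fun _ => C) (fun n => (hf n).aestronglyMeasurable)
    (integrable_const C) (fun n => .of_forall (hC n)) (.of_forall hlim)

end BoundedMeasurable

namespace ProjValuedMeasure

open MeasureTheory Filter Topology

variable {𝓗 : Type} [NormedAddCommGroup 𝓗] [InnerProductSpace ℂ 𝓗] [CompleteSpace 𝓗]

section Projections

variable (Q : ProjValuedMeasure 𝓗)

theorem proj_proj {B C : Set ℝ} (hB : MeasurableSet B) (hC : MeasurableSet C) (ψ : 𝓗) :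
    Q.proj B (Q.proj C ψ) = Q.proj (B ∩ C) ψ := by
  rw [Q.proj_inter B C hB hC, mul_apply_eq_comp]

theorem inner_proj_left {B : Set ℝ} (hB : MeasurableSet B) (φ ψ : 𝓗) :
    ⟪Q.proj B φ, ψ⟫_ℂ = ⟪φ, Q.proj B ψ⟫_ℂ :=
  (Q.isStarProjection B hB).isSelfAdjoint.isSymmetric φ ψ

theorem inner_proj_self {B : Set ℝ} (hB : MeasurableSet B) (ψ : 𝓗) :
    ⟪ψ, Q.proj B ψ⟫_ℂ = ((‖Q.proj B ψ‖ ^ 2 : ℝ) : ℂ) := by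
  have h : Q.proj B (Q.proj B ψ) = Q.proj B ψ := by rw [Q.proj_proj hB hB, Set.inter_self]
  rw [← h, ← Q.inner_proj_left hB, h, inner_self_eq_norm_sq_to_K]
  simp

theorem scalarMeasure_apply {B : Set ℝ} (hB : MeasurableSet B) (ψ : 𝓗) :
    Q.scalarMeasure ψ B = ENNReal.ofReal (‖Q.proj B ψ‖ ^ 2) := by
  rw [scalarMeasure, Measure.ofMeasurable_apply _ hB, Q.inner_proj_self hB, Complex.ofReal_re]

theorem measureReal_scalarMeasure {B : Set ℝ} (hB : MeasurableSet B) (ψ : 𝓗) :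
    (Q.scalarMeasure ψ).real B = ‖Q.proj B ψ‖ ^ 2 := by
  rw [Measure.real, Q.scalarMeasure_apply hB, ENNReal.toReal_ofReal (by positivity)]

instance isFiniteMeasure_scalarMeasure (ψ : 𝓗) : IsFiniteMeasure (Q.scalarMeasure ψ) :=
  ⟨by rw [Q.scalarMeasure_apply .univ]; exact ENNReal.ofReal_lt_top⟩

theorem measureReal_scalarMeasure_univ (ψ : 𝓗) : (Q.scalarMeasure ψ).real Set.univ = ‖ψ‖ ^ 2 := by
  rw [Q.measureReal_scalarMeasure .univ, Q.proj_univ, one_apply_eq_self]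

theorem isIntegral_indicator_one {B : Set ℝ} (hB : MeasurableSet B) :
    Q.IsIntegral (B.indicator 1) (Q.proj B) := by
  intro ψ
  rw [Q.inner_proj_self hB, integral_indicator hB, ← Q.measureReal_scalarMeasure hB]
  simp

end Projections

namespace IsIntegral

variable {Q : ProjValuedMeasure 𝓗} {f g : ℝ → ℂ} {S T : 𝓗 →L[ℂ] 𝓗}

theorem unique (hS : Q.IsIntegral f S) (hT : Q.IsIntegral f T) : S = T := by
  refine ContinuousLinearMap.coe_injective ((ext_inner_map _ _).1 fun ψ => ?_)
  simpa only [inner_conj_symm, ContinuousLinearMap.coe_coe]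
    using congrArg (starRingEnd ℂ) ((hS ψ).trans (hT ψ).symm)

theorem add (hS : Q.IsIntegral f S) (hT : Q.IsIntegral g T) (hf : IsBddMeasurable f)
    (hg : IsBddMeasurable g) : Q.IsIntegral (f + g) (S + T) := by
  intro ψ
  rw [add_apply, inner_add_right, hS, hT]
  exact (integral_add (hf.integrable _) (hg.integrable _)).symm

theorem const_smul (hS : Q.IsIntegral f S) (c : ℂ) : Q.IsIntegral (c • f) (c • S) := by
  intro ψ
  rw [smul_apply, inner_smul_right, hS]
  exact (integral_smul c f).symm

theorem star (hS : Q.IsIntegral f S) : Q.IsIntegral (star f) (star S) := by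
  intro ψ
  rw [ContinuousLinearMap.star_eq_adjoint, ContinuousLinearMap.adjoint_inner_right,
    ← inner_conj_symm, hS]
  exact integral_conj.symm

theorem tendsto_inner {f : ℕ → ℝ → ℂ} {T : ℕ → 𝓗 →L[ℂ] 𝓗} {C : ℝ}
    (hT : ∀ n, Q.IsIntegral (f n) (T n)) (hS : Q.IsIntegral g S)
    (hf : ∀ n, Measurable (f n)) (hC : ∀ n x, ‖f n x‖ ≤ C)
    (hlim : ∀ x, Tendsto (fun n => f n x) atTop (𝓝 (g x))) (φ ψ : 𝓗) :
    Tendsto (fun n => ⟪φ, T n ψ⟫_ℂ) atTop (𝓝 ⟪φ, S ψ⟫_ℂ) := by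
  have hdiag (χ : 𝓗) : Tendsto (fun n => ⟪T n χ, χ⟫_ℂ) atTop (𝓝 ⟪S χ, χ⟫_ℂ) := by
    have h := tendsto_integral_of_forall_norm_le hf hC hlim (Q.scalarMeasure χ)
    simp only [← hT _ χ, ← hS χ] at h
    simpa only [RCLike.star_def, inner_conj_symm] using h.star
  have hleft : Tendsto (fun n => ⟪T n ψ, φ⟫_ℂ) atTop (𝓝 ⟪S ψ, φ⟫_ℂ) := by
    have hpolar (R : 𝓗 →L[ℂ] 𝓗) := inner_map_polarization' (R : 𝓗 →ₗ[ℂ] 𝓗) ψ φ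
    simp only [ContinuousLinearMap.coe_coe] at hpolar
    simp only [hpolar]
    exact (((((hdiag _).sub (hdiag _)).sub ((hdiag _).const_mul _)).add
      ((hdiag _).const_mul _)).div_const _)
  simpa only [RCLike.star_def, inner_conj_symm] using hleft.star

/-- For fixed `f` both sides are linear in `g` and continuous under bounded pointwise limits, so it
suffices to test on indicator functions. -/
theorem mul_of_forall_indicator (hT : Q.IsIntegral g T) (hf : IsBddMeasurable f)
    (hg : IsBddMeasurable g)
    (hind : ∀ B, MeasurableSet B → Q.IsIntegral (f * B.indicator 1) (S * Q.proj B)) :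
    Q.IsIntegral (f * g) (S * T) := by
  have hsimple (s : SimpleFunc ℝ ℂ) : ∃ R, Q.IsIntegral s R ∧ Q.IsIntegral (f * s) (S * R) := by
    induction s using SimpleFunc.induction with
    | @const c B hB =>
      have hs : ⇑(SimpleFunc.piecewise B hB (.const ℝ c) (.const ℝ 0)) = c • B.indicator 1 := by
        ext x
        by_cases hx : x ∈ B <;> simp [hx]
      refine ⟨c • Q.proj B, hs ▸ (Q.isIntegral_indicator_one hB).const_smul c, ?_⟩
      rw [hs, mul_smul_comm, mul_smul_comm]
      exact (hind B hB).const_smul c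
    | @add s s' _ hs hs' =>
      obtain ⟨R, hR, hSR⟩ := hs
      obtain ⟨R', hR', hSR'⟩ := hs'
      have hs := IsBddMeasurable.simpleFunc s
      have hs' := IsBddMeasurable.simpleFunc s'
      refine ⟨R + R', hR.add hR' hs hs', ?_⟩
      rw [SimpleFunc.coe_add, mul_add, mul_add]
      exact hSR.add hSR' (hf.mul hs) (hf.mul hs')
  obtain ⟨s, K, hK, hlim⟩ := hg.exists_tendsto_simpleFunc
  choose R hR hSR using fun n => hsimple (s n)
  obtain ⟨hfm, C, hC⟩ := hf
  intro ψ
  have hinner := tendsto_inner hR hT (fun n => (s n).measurable) hK hlim (Star.star S ψ) ψ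
  simp only [ContinuousLinearMap.star_eq_adjoint, ContinuousLinearMap.adjoint_inner_left] at hinner
  have hintegral := tendsto_integral_of_forall_norm_le
    (fun n => hfm.mul (s n).measurable) (fun n x => norm_mul_le_of_le (hC x) (hK n x))
    (fun x => (hlim x).const_mul (f x)) (Q.scalarMeasure ψ)
  exact tendsto_nhds_unique hinner (hintegral.congr fun n => (hSR n ψ).symm)

theorem mul_proj (hT : Q.IsIntegral f T) (hf : IsBddMeasurable f) {B : Set ℝ}
    (hB : MeasurableSet B) : Q.IsIntegral (f * B.indicator 1) (T * Q.proj B) := by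
  have hproj : Q.IsIntegral (B.indicator 1 * Star.star f) (Q.proj B * Star.star T) := by
    refine hT.star.mul_of_forall_indicator (.indicator_one hB) hf.star fun C hC => ?_
    rw [← Q.proj_inter B C hB hC, ← Set.inter_indicator_one]
    exact Q.isIntegral_indicator_one (hB.inter hC)
  have hind : Star.star (B.indicator (1 : ℝ → ℂ)) = B.indicator 1 := by
    ext x
    by_cases hx : x ∈ B <;> simp [hx]
  simpa only [star_mul, star_star, hind, (Q.isStarProjection B hB).isSelfAdjoint.star_eq]
    using hproj.star

theorem mul (hS : Q.IsIntegral f S) (hT : Q.IsIntegral g T) (hf : IsBddMeasurable f)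
    (hg : IsBddMeasurable g) : Q.IsIntegral (f * g) (S * T) :=
  hT.mul_of_forall_indicator hf hg fun _ => hS.mul_proj hf

theorem commute_proj (hT : Q.IsIntegral f T) (hf : IsBddMeasurable f) {B : Set ℝ}
    (hB : MeasurableSet B) : Commute T (Q.proj B) := by
  refine (hT.mul_proj hf hB).unique ?_
  rw [mul_comm]
  exact (Q.isIntegral_indicator_one hB).mul hT (.indicator_one hB) hf

end IsIntegral

end ProjValuedMeasure

theorem norm_apply_le_of_isSymmetric_of_abs_re_inner_le {𝕜 V : Type*} [RCLike 𝕜]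
    [NormedAddCommGroup V] [InnerProductSpace 𝕜 V] [CompleteSpace V] {T : V →ₗ[𝕜] V}
    (hT : T.IsSymmetric) {δ : ℝ} (hδ : 0 ≤ δ) (h : ∀ x, |RCLike.re ⟪T x, x⟫_𝕜| ≤ δ * ‖x‖ ^ 2)
    (x : V) : ‖T x‖ ≤ δ * ‖x‖ := by
  let T' : V →L[𝕜] V := ⟨T, hT.continuous⟩
  have hnorm : ‖T'‖ ≤ δ := by
    rw [ContinuousLinearMap.norm_eq_iSup_rayleighQuotient T' hT]
    refine ciSup_le fun y => ?_
    rw [ContinuousLinearMap.rayleighQuotient, abs_div, abs_of_nonneg (sq_nonneg ‖y‖)]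
    exact div_le_of_le_mul₀ (sq_nonneg _) hδ (h y)
  exact T'.le_of_opNorm_le hnorm x

namespace ProjValuedMeasure

open MeasureTheory Filter Topology

variable {𝓗 : Type} [NormedAddCommGroup 𝓗] [InnerProductSpace ℂ 𝓗] [CompleteSpace 𝓗]

/-- The range of the projection `Q.proj B` (for measurable `B`), described as the set of its fixed
vectors. -/
def spectralSubspace (Q : ProjValuedMeasure 𝓗) (B : Set ℝ) : Submodule ℂ 𝓗 :=
  LinearMap.eqLocus (Q.proj B : 𝓗 →ₗ[ℂ] 𝓗) LinearMap.id

variable {Q : ProjValuedMeasure 𝓗} {B : Set ℝ} {φ ψ : 𝓗}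

theorem mem_spectralSubspace : φ ∈ Q.spectralSubspace B ↔ Q.proj B φ = φ :=
  Iff.rfl

theorem proj_mem_spectralSubspace (hB : MeasurableSet B) (ψ : 𝓗) :
    Q.proj B ψ ∈ Q.spectralSubspace B := by
  rw [mem_spectralSubspace, Q.proj_proj hB hB, Set.inter_self]

instance completeSpace_spectralSubspace : CompleteSpace (Q.spectralSubspace B) :=
  (isClosed_eq (Q.proj B).continuous continuous_id).completeSpace_coe

theorem ae_mem_of_mem_spectralSubspace (hB : MeasurableSet B) (hφ : φ ∈ Q.spectralSubspace B) :
    ∀ᵐ e ∂Q.scalarMeasure φ, e ∈ B := by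
  rw [ae_iff, ← Set.compl_ofPred, Set.ofPred_mem_eq, Q.scalarMeasure_apply hB.compl,
    ← mem_spectralSubspace.1 hφ, Q.proj_proj hB.compl hB, Set.compl_inter_self, Q.proj_empty]
  simp

theorem integrable_of_mem_spectralSubspace (hB : MeasurableSet B) (hbdd : Bornology.IsBounded B)
    (hφ : φ ∈ Q.spectralSubspace B) {f : ℝ → ℝ} (hf : Continuous f) :
    Integrable f (Q.scalarMeasure φ) := by
  obtain ⟨C, hC⟩ := hbdd.isCompact_closure.exists_bound_of_continuousOn hf.continuousOn
  refine .of_bound hf.aestronglyMeasurable C ?_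
  filter_upwards [ae_mem_of_mem_spectralSubspace hB hφ] with e he using hC e (subset_closure he)

theorem scalarMeasure_add_of_proj_eq_zero (hB : MeasurableSet B) (hφ : φ ∈ Q.spectralSubspace B)
    (hψ : Q.proj B ψ = 0) :
    Q.scalarMeasure (ψ + φ) = Q.scalarMeasure ψ + Q.scalarMeasure φ := by
  ext C hC
  have horth : ⟪Q.proj C ψ, Q.proj C φ⟫_ℂ = 0 := by
    rw [← mem_spectralSubspace.1 hφ, Q.proj_proj hC hB, Set.inter_comm, ← Q.proj_proj hB hC,
      ← Q.inner_proj_left hB, Q.proj_proj hB hC, Set.inter_comm, ← Q.proj_proj hC hB, hψ,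
      map_zero, inner_zero_left]
  rw [Measure.add_apply, Q.scalarMeasure_apply hC, Q.scalarMeasure_apply hC,
    Q.scalarMeasure_apply hC, ← ENNReal.ofReal_add (by positivity) (by positivity), map_add]
  simp only [sq, norm_add_sq_eq_norm_sq_add_norm_sq_of_inner_eq_zero _ _ horth]

namespace IsSpectralMeasureOf

variable {H : 𝓗 →ₗ.[ℂ] 𝓗}

theorem integrable_id (hQ : Q.IsSpectralMeasureOf H) (ψ : H.domain) :
    Integrable (fun e : ℝ => e) (Q.scalarMeasure ψ) := by
  have hsq : MemLp (fun e : ℝ => e) 2 (Q.scalarMeasure ψ) :=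
    (memLp_two_iff_integrable_sq measurable_id.aestronglyMeasurable).2 ((hQ.1 ψ).1 ψ.2)
  exact hsq.integrable (by norm_num)

theorem spectralSubspace_le_domain (hQ : Q.IsSpectralMeasureOf H) (hB : MeasurableSet B)
    (hbdd : Bornology.IsBounded B) : Q.spectralSubspace B ≤ H.domain := fun φ hφ =>
  (hQ.1 φ).2 (integrable_of_mem_spectralSubspace hB hbdd hφ (by fun_prop))

/-- `ψ + z • φ` has spectral measure `μ_ψ + μ_{zφ}`, so the quadratic form of `H` has no cross
terms. -/
theorem inner_map_eq_zero (hQ : Q.IsSpectralMeasureOf H) (hB : MeasurableSet B) {φ ψ : H.domain}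
    (hφ : (φ : 𝓗) ∈ Q.spectralSubspace B) (hψ : Q.proj B ψ = 0) : ⟪(ψ : 𝓗), H φ⟫_ℂ = 0 := by
  have hcross (z : ℂ) : z * ⟪(ψ : 𝓗), H φ⟫_ℂ + starRingEnd ℂ z * ⟪(φ : 𝓗), H ψ⟫_ℂ = 0 := by
    have h := hQ.2 (ψ + z • φ)
    rw [Submodule.coe_add, scalarMeasure_add_of_proj_eq_zero hB
        (φ := ((z • φ : H.domain) : 𝓗)) ((Q.spectralSubspace B).smul_mem z hφ) hψ,
      integral_add_measure (hQ.integrable_id ψ) (hQ.integrable_id (z • φ)), Complex.ofReal_add,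
      ← hQ.2, ← hQ.2, LinearPMap.map_add, inner_add_left, inner_add_right, inner_add_right,
      LinearPMap.map_smul, Submodule.coe_smul, inner_smul_right _ _ z, inner_smul_left _ (H ψ)] at h
    linear_combination h
  have h1 := hcross 1
  have hI := hcross Complex.I
  simp only [map_one, one_mul, Complex.conj_I] at h1 hI
  linear_combination (h1 - Complex.I * hI +
    (⟪(ψ : 𝓗), H φ⟫_ℂ - ⟪(φ : 𝓗), H ψ⟫_ℂ) * Complex.I_mul_I) / 2

theorem map_mem_spectralSubspace (hQ : Q.IsSpectralMeasureOf H) (hdense : Dense (H.domain : Set 𝓗))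
    (hB : MeasurableSet B) (hbdd : Bornology.IsBounded B) {φ : H.domain}
    (hφ : (φ : 𝓗) ∈ Q.spectralSubspace B) : H φ ∈ Q.spectralSubspace B := by
  rw [mem_spectralSubspace, ← sub_eq_zero, ← neg_sub, neg_eq_zero]
  refine hdense.eq_zero_of_inner_right (𝕜 := ℂ) fun v hv => ?_
  have hdom : Q.proj B v ∈ H.domain :=
    hQ.spectralSubspace_le_domain hB hbdd (proj_mem_spectralSubspace hB v)
  have hker : Q.proj B (v - Q.proj B v) = 0 := by
    rw [map_sub, Q.proj_proj hB hB, Set.inter_self, sub_self]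
  have h := hQ.inner_map_eq_zero hB (ψ := ⟨v, hv⟩ - ⟨_, hdom⟩) hφ hker
  rwa [Submodule.coe_sub, inner_sub_left, Q.inner_proj_left hB, ← inner_sub_right] at h

/-- The restriction of `H` to the spectral subspace of a bounded set; it is everywhere defined
there. -/
def restrict (hQ : Q.IsSpectralMeasureOf H) (hdense : Dense (H.domain : Set 𝓗))
    (hB : MeasurableSet B) (hbdd : Bornology.IsBounded B) :
    Q.spectralSubspace B →ₗ[ℂ] Q.spectralSubspace B :=
  (H.toFun ∘ₗ Submodule.inclusion (hQ.spectralSubspace_le_domain hB hbdd)).codRestrict _ fun φ =>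
    hQ.map_mem_spectralSubspace hdense hB hbdd φ.2

theorem isSymmetric_restrict (hQ : Q.IsSpectralMeasureOf H) (hH : IsSelfAdjoint H)
    (hB : MeasurableSet B) (hbdd : Bornology.IsBounded B) :
    (hQ.restrict hH.dense_domain hB hbdd).IsSymmetric := fun φ ψ => by
  have h := LinearPMap.adjoint_isFormalAdjoint hH.dense_domain
  rw [LinearPMap.isSelfAdjoint_def.1 hH] at h
  exact h ⟨φ, _⟩ ⟨ψ, _⟩

theorem norm_map_sub_smul_le (hQ : Q.IsSpectralMeasureOf H) (hH : IsSelfAdjoint H) {e δ : ℝ}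
    (hδ : 0 ≤ δ) {φ : H.domain}
    (hφ : (φ : 𝓗) ∈ Q.spectralSubspace (Set.Ioo (e - δ) (e + δ))) :
    ‖H φ - (e : ℂ) • (φ : 𝓗)‖ ≤ δ * ‖(φ : 𝓗)‖ := by
  have hB : MeasurableSet (Set.Ioo (e - δ) (e + δ)) := measurableSet_Ioo
  have hbdd := Metric.isBounded_Ioo (e - δ) (e + δ)
  let T := hQ.restrict hH.dense_domain hB hbdd - (e : ℂ) • LinearMap.id
  have hT : T.IsSymmetric :=
    (hQ.isSymmetric_restrict hH hB hbdd).sub (LinearMap.IsSymmetric.id.smul (Complex.conj_ofReal e))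
  refine norm_apply_le_of_isSymmetric_of_abs_re_inner_le hT hδ (fun ψ => ?_) ⟨φ, hφ⟩
  have hform : (⟪T ψ, ψ⟫_ℂ).re = ∫ x, (x - e) ∂Q.scalarMeasure (ψ : 𝓗) := by
    have hHψ := hQ.2 ⟨ψ, hQ.spectralSubspace_le_domain hB hbdd ψ.2⟩
    rw [hT, integral_sub (hQ.integrable_id ⟨ψ, hQ.spectralSubspace_le_domain hB hbdd ψ.2⟩)
      (integrable_const e), integral_const, Q.measureReal_scalarMeasure_univ, LinearMap.sub_apply,
      inner_sub_right, Complex.sub_re, ← Complex.ofReal_re (∫ x, x ∂_), ← hHψ, LinearMap.smul_apply,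
      LinearMap.id_apply, inner_smul_right, Complex.re_ofReal_mul, mul_comm e]
    congr 2
    exact inner_self_eq_norm_sq (𝕜 := ℂ) ψ
  rw [RCLike.re_eq_complex_re, hform, Submodule.coe_norm, ← Q.measureReal_scalarMeasure_univ]
  refine norm_integral_le_of_norm_le_const (f := fun x => x - e) ?_
  filter_upwards [ae_mem_of_mem_spectralSubspace hB ψ.2] with x hx
  rw [Real.norm_eq_abs, abs_le]
  constructor <;> linarith [hx.1, hx.2]

theorem exists_proj_Ioo_eq_zero (hQ : Q.IsSpectralMeasureOf H) (hH : IsSelfAdjoint H) {e : ℝ}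
    (he : InResolventSet H e) : ∃ δ > 0, Q.proj (Set.Ioo (e - δ) (e + δ)) = 0 := by
  obtain ⟨R, -, hR⟩ := he
  have hpos : 0 < ‖R‖ + 1 := by positivity
  refine ⟨(‖R‖ + 1)⁻¹, inv_pos.2 hpos, ContinuousLinearMap.ext fun ψ => ?_⟩
  have hφ := proj_mem_spectralSubspace (Q := Q)
    (measurableSet_Ioo (a := e - (‖R‖ + 1)⁻¹) (b := e + (‖R‖ + 1)⁻¹)) ψ
  have hdom := hQ.spectralSubspace_le_domain measurableSet_Ioo (Metric.isBounded_Ioo _ _) hφ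
  generalize Q.proj _ ψ = φ at hφ hdom
  have hle : ‖φ‖ ≤ ‖R‖ * ((‖R‖ + 1)⁻¹ * ‖φ‖) := by
    have h := R.le_opNorm_of_le
      (hQ.norm_map_sub_smul_le hH (φ := ⟨φ, hdom⟩) (inv_pos.2 hpos).le hφ)
    rwa [hR] at h
  field_simp at hle
  exact norm_le_zero_iff.1 (by linarith)

theorem proj_Ioo_zero_eq_zero (hQ : Q.IsSpectralMeasureOf H)
    (hpos : ∀ ψ : H.domain, 0 ≤ (⟪(ψ : 𝓗), H ψ⟫_ℂ).re) (a : ℝ) : Q.proj (Set.Ioo a 0) = 0 := by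
  refine ContinuousLinearMap.ext fun ψ => ?_
  have hB : MeasurableSet (Set.Ioo a 0) := measurableSet_Ioo
  have hφ := proj_mem_spectralSubspace (Q := Q) hB ψ
  have hdom := hQ.spectralSubspace_le_domain hB (Metric.isBounded_Ioo _ _) hφ
  generalize Q.proj _ ψ = φ at hφ hdom
  have hneg := ae_mem_of_mem_spectralSubspace hB hφ
  have hintegral : ∫ x, x ∂Q.scalarMeasure φ = 0 := by
    refine le_antisymm (integral_nonpos_of_ae ?_) ?_
    · filter_upwards [hneg] with x hx using hx.2.le
    · have h := hpos ⟨φ, hdom⟩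
      rwa [hQ.2, Complex.ofReal_re] at h
  have hzero : ∀ᵐ x ∂Q.scalarMeasure φ, -x = 0 := by
    refine (integral_eq_zero_iff_of_nonneg_ae ?_ (hQ.integrable_id ⟨φ, hdom⟩).neg).1 ?_
    · filter_upwards [hneg] with x hx using neg_nonneg.2 hx.2.le
    · exact (integral_neg _).trans (neg_eq_zero.2 hintegral)
  have hbot : ae (Q.scalarMeasure φ) = ⊥ := by
    refine eventually_false_iff_eq_bot.1 ?_
    filter_upwards [hneg, hzero] with x hx h0
    linarith [hx.2]
  rw [zero_apply, ← norm_eq_zero, ← sq_eq_zero_iff, ← Q.measureReal_scalarMeasure_univ,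
    ae_eq_bot.1 hbot, measureReal_zero_apply]

theorem scalarMeasure_compl_realSpectrum_inter_Ici (hQ : Q.IsSpectralMeasureOf H)
    (hH : IsSelfAdjoint H) (hpos : ∀ ψ : H.domain, 0 ≤ (⟪(ψ : 𝓗), H ψ⟫_ℂ).re) (ψ : 𝓗) :
    Q.scalarMeasure ψ (realSpectrum H ∩ Set.Ici 0)ᶜ = 0 := by
  refine measure_null_of_locally_null _ fun e he => ?_
  have hnull {a b : ℝ} (ha : a < e) (hb : e < b) (h : Q.proj (Set.Ioo a b) = 0) :
      ∃ u ∈ 𝓝[(realSpectrum H ∩ Set.Ici 0)ᶜ] e, Q.scalarMeasure ψ u = 0 :=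
    ⟨_, mem_nhdsWithin_of_mem_nhds (Ioo_mem_nhds ha hb), by
      simp [Q.scalarMeasure_apply measurableSet_Ioo, h]⟩
  rcases lt_or_ge e 0 with hneg | hnonneg
  · exact hnull (sub_one_lt e) hneg (hQ.proj_Ioo_zero_eq_zero hpos _)
  · obtain ⟨δ, hδ, h⟩ := hQ.exists_proj_Ioo_eq_zero hH
      (by_contra fun hres => he ⟨hres, hnonneg⟩)
    exact hnull (by linarith) (by linarith) h

end IsSpectralMeasureOf

end ProjValuedMeasure

section HilbertSchmidt

theorem exists_hasSum_of_hasSum_mul {ι κ 𝕜 : Type*} [NormedField 𝕜] [CompleteSpace 𝕜]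
    {c d : ι × κ → 𝕜} (hc : Summable fun q => ‖c q‖ ^ 2) (hd : Summable fun q => ‖d q‖ ^ 2)
    {x : ι → 𝕜} {y : κ → 𝕜} (hx : ∀ i, HasSum (fun k => c (i, k) * d (i, k)) (x i))
    (hy : ∀ k, HasSum (fun i => c (i, k) * d (i, k)) (y k)) : ∃ z, HasSum x z ∧ HasSum y z := by
  obtain ⟨z, hz⟩ : Summable fun q => c q * d q := by
    refine .of_norm_bounded (hc.add hd) fun q => ?_
    rw [norm_mul]
    linarith [two_mul_le_add_sq ‖c q‖ ‖d q‖, mul_nonneg (norm_nonneg (c q)) (norm_nonneg (d q))]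
  exact ⟨z, hz.prod_fiberwise hx, ((Equiv.prodComm κ ι).hasSum_iff.2 hz).prod_fiberwise hy⟩

variable {𝕜 V ι : Type*} [RCLike 𝕜] [NormedAddCommGroup V] [InnerProductSpace 𝕜 V]

theorem hasSum_norm_inner_hilbertBasis_sq (b : HilbertBasis ι 𝕜 V) (x : V) :
    HasSum (fun i => ‖⟪b i, x⟫_𝕜‖ ^ 2) (‖x‖ ^ 2) := by
  simpa [b.repr_apply_apply] using lp.hasSum_norm (p := 2) (by norm_num) (b.repr x)

theorem summable_norm_inner_hilbertBasis_apply_sq (b : HilbertBasis ι 𝕜 V) {T : V →L[𝕜] V}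
    (hT : Summable fun i => ‖T (b i)‖ ^ 2) :
    Summable fun q : ι × ι => ‖⟪b q.2, T (b q.1)⟫_𝕜‖ ^ 2 := by
  refine (summable_prod_of_nonneg fun _ => by positivity).2
    ⟨fun i => (hasSum_norm_inner_hilbertBasis_sq b (T (b i))).summable, ?_⟩
  simpa only [(hasSum_norm_inner_hilbertBasis_sq b _).tsum_eq] using hT

theorem exists_hasSum_inner_hilbertSchmidt [CompleteSpace V] (b : HilbertBasis ι 𝕜 V)
    {S T : V →L[𝕜] V} (hS : Summable fun i => ‖S (b i)‖ ^ 2)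
    (hT : Summable fun i => ‖T (b i)‖ ^ 2) :
    ∃ z, HasSum (fun i => ⟪S (b i), T (b i)⟫_𝕜) z ∧
      HasSum (fun i => ⟪star T (b i), star S (b i)⟫_𝕜) z := by
  refine exists_hasSum_of_hasSum_mul (c := fun q => ⟪S (b q.1), b q.2⟫_𝕜)
    (d := fun q => ⟪b q.2, T (b q.1)⟫_𝕜) ?_ (summable_norm_inner_hilbertBasis_apply_sq b hT)
    (fun i => b.hasSum_inner_mul_inner _ _) fun i => ?_
  · simpa only [norm_inner_symm (b _)] using summable_norm_inner_hilbertBasis_apply_sq b hS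
  · have h := b.hasSum_inner_mul_inner (star T (b i)) (star S (b i))
    simp only [ContinuousLinearMap.star_eq_adjoint, ContinuousLinearMap.adjoint_inner_left,
      ContinuousLinearMap.adjoint_inner_right _ (b _)] at h ⊢
    simpa only [mul_comm] using h

theorem summable_norm_apply_sq {v : ι → V} (hv : Summable fun i => ‖v i‖ ^ 2) (T : V →L[𝕜] V) :
    Summable fun i => ‖T (v i)‖ ^ 2 := by
  refine .of_nonneg_of_le (fun i => by positivity) (fun i => ?_) (hv.mul_left (‖T‖ ^ 2))
  rw [← mul_pow]
  exact pow_le_pow_left₀ (norm_nonneg _) (T.le_opNorm _) 2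

end HilbertSchmidt

section VectorFunctional

variable {𝓗 ι : Type*} [NormedAddCommGroup 𝓗] [InnerProductSpace ℂ 𝓗] {v : ι → 𝓗}

theorem summable_inner_apply (hv : Summable fun i => ‖v i‖ ^ 2) (T : 𝓗 →L[ℂ] 𝓗) :
    Summable fun i => ⟪v i, T (v i)⟫_ℂ := by
  refine .of_norm_bounded (hv.mul_left ‖T‖) fun i => ?_
  calc ‖⟪v i, T (v i)⟫_ℂ‖ ≤ ‖v i‖ * ‖T (v i)‖ := norm_inner_le_norm _ _
    _ ≤ ‖v i‖ * (‖T‖ * ‖v i‖) := by gcongr; exact T.le_opNorm _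
    _ = ‖T‖ * ‖v i‖ ^ 2 := by ring

variable [CompleteSpace 𝓗]

/-- The positive functional `T ↦ ∑ i, ⟪v i, T (v i)⟫` of a square-summable family of vectors, that
is `T ↦ tr (ρ T)` for the trace class operator `ρ = ∑ i, |v i⟩⟨v i|`. -/
def vectorFunctional (hv : Summable fun i => ‖v i‖ ^ 2) : (𝓗 →L[ℂ] 𝓗) →ₚ[ℂ] ℂ :=
  .mk₀
    { toFun T := ∑' i, ⟪v i, T (v i)⟫_ℂ
      map_add' S T := by
        rw [← (summable_inner_apply hv S).tsum_add (summable_inner_apply hv T)]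
        simp only [add_apply, inner_add_right]
      map_smul' c T := by
        simp only [smul_apply, inner_smul_right, RingHom.id_apply, smul_eq_mul, tsum_mul_left] }
    fun T hT => tsum_nonneg fun i => ((T.nonneg_iff_isPositive).1 hT).inner_nonneg_right (v i)

theorem hasSum_vectorFunctional (hv : Summable fun i => ‖v i‖ ^ 2) (T : 𝓗 →L[ℂ] 𝓗) :
    HasSum (fun i => ⟪v i, T (v i)⟫_ℂ) (vectorFunctional hv T) :=
  (summable_inner_apply hv T).hasSum

end VectorFunctional

/-- With `σ` the square root of `ρ`, take the vectors `σ (b i)` for a Hilbert basis `b`. -/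
theorem exists_vectorFunctional_of_hasTrace {𝓗 : Type} [NormedAddCommGroup 𝓗]
    [InnerProductSpace ℂ 𝓗] [CompleteSpace 𝓗] {ρ : 𝓗 →L[ℂ] 𝓗} {r : ℂ} (hρ : ρ.IsPositive)
    (hr : HasTrace ρ r) :
    ∃ (ι : Type) (v : ι → 𝓗) (hv : Summable fun i => ‖v i‖ ^ 2), ∀ (G F : 𝓗 →L[ℂ] 𝓗) (z : ℂ),
      HasTrace (G * ρ * star G * F) z → vectorFunctional hv (star G * F * G) = z := by
  obtain ⟨σ, hσ, rfl⟩ : ∃ σ : 𝓗 →L[ℂ] 𝓗, star σ = σ ∧ σ * σ = ρ :=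
    ⟨CFC.sqrt ρ, (CFC.sqrt_nonneg ρ).isSelfAdjoint,
      CFC.sqrt_mul_sqrt_self ρ (ρ.nonneg_iff_isPositive.2 hρ)⟩
  have hadj (T : 𝓗 →L[ℂ] 𝓗) (x y : 𝓗) : ⟪star T x, y⟫_ℂ = ⟪x, T y⟫_ℂ :=
    ContinuousLinearMap.adjoint_inner_left T y x
  obtain ⟨S, b, -⟩ := exists_hilbertBasis ℂ 𝓗
  have hv : Summable fun i => ‖σ (b i)‖ ^ 2 := by
    refine ((hr S b).mapL Complex.reCLM).summable.congr fun i => ?_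
    rw [mul_apply_eq_comp, ← hadj, hσ]
    exact inner_self_eq_norm_sq (𝕜 := ℂ) (σ (b i))
  refine ⟨S, fun i => σ (b i), hv, fun G F z hz => ?_⟩
  obtain ⟨z', hST, hTS⟩ := exists_hasSum_inner_hilbertSchmidt b (S := star F * G * σ)
    (T := G * σ) (summable_norm_apply_sq hv (star F * G)) (summable_norm_apply_sq hv G)
  have hz' : z = z' := by
    refine (hz S b).unique (hTS.congr_fun fun i => ?_)
    rw [hadj, star_mul, star_mul, star_star, hσ]
    rfl
  rw [hz']
  refine (hasSum_vectorFunctional hv _).unique (hST.congr_fun fun i => ?_)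
  have hGF : star (star F * G) = star G * F := by rw [star_mul, star_star]
  rw [← hGF]
  exact ContinuousLinearMap.adjoint_inner_right (star F * G) _ _

section CompressionMatrix

variable {𝓐 κ : Type*} [CStarAlgebra 𝓐] [PartialOrder 𝓐]

/-- The compression of `F` along the family `V`, with respect to the sesquilinear form
`(S, T) ↦ τ (star S * T)` of a positive functional `τ`. -/
def compressionMatrix (τ : 𝓐 →ₚ[ℂ] ℂ) (V : κ → 𝓐) (F : 𝓐) : Matrix κ κ ℂ :=
  Matrix.of fun u w => τ (star (V u) * F * V w)

variable (τ : 𝓐 →ₚ[ℂ] ℂ) (V : κ → 𝓐)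

theorem sum_compressionMatrix {α : Type*} (s : Finset α) (F : α → 𝓐) :
    ∑ a ∈ s, compressionMatrix τ V (F a) = compressionMatrix τ V (∑ a ∈ s, F a) := by
  ext u w
  simp only [Matrix.sum_apply, compressionMatrix, Matrix.of_apply, Finset.mul_sum, Finset.sum_mul,
    map_sum]

theorem dotProduct_compressionMatrix_mulVec [Fintype κ] (F : 𝓐) (c : κ → ℂ) :
    star c ⬝ᵥ (compressionMatrix τ V F *ᵥ c) =
      τ (star (∑ u, c u • V u) * F * ∑ u, c u • V u) := by
  simp only [dotProduct, Matrix.mulVec, compressionMatrix, Matrix.of_apply, Pi.star_apply,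
    Finset.mul_sum, star_sum, star_smul, Finset.sum_mul, smul_mul_assoc, mul_smul_comm, map_sum,
    map_smul, smul_eq_mul]
  rw [Finset.sum_comm]
  exact Finset.sum_congr rfl fun w _ => Finset.sum_congr rfl fun u _ => by ring

theorem posSemidef_compressionMatrix [StarOrderedRing 𝓐] [Finite κ] {F : 𝓐} (hF : 0 ≤ F) :
    (compressionMatrix τ V F).PosSemidef := by
  have := Fintype.ofFinite κ
  refine .of_dotProduct_mulVec_nonneg ?_ fun c => ?_
  · ext u w
    rw [Matrix.conjTranspose_apply, compressionMatrix, Matrix.of_apply, Matrix.of_apply,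
      ← map_star, star_mul, star_mul, star_star, (IsSelfAdjoint.of_nonneg hF).star_eq, mul_assoc]
  · rw [dotProduct_compressionMatrix_mulVec]
    exact τ.map_nonneg (star_left_conjugate_nonneg hF _)

end CompressionMatrix

section Certificates

variable {ι α ξ : Type*} {N m : ℕ}

/-- The operator `diag(p_0, …, p_{m-1}) ⊕ γ` on `ℂ^m ⊕ ℂ^ι`. -/
def stateMatrix (p : Fin (m + 1) → ℝ) (γ : Matrix ι ι ℂ) : Matrix (Fin m ⊕ ι) (Fin m ⊕ ι) ℂ :=
  .fromBlocks (.diagonal fun k => (p k.castSucc : ℂ)) 0 0 γ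

/-- The triples `(p, γ, M)` that witness membership of a dataset in the closure of the set of soft
spectral datasets, normalized so that the diagonal of `γ` is the high-energy weight. -/
structure IsCertificate [Fintype α] (ε : ℝ) (t : Fin N → ℝ) (p : Fin (m + 1) → ℝ)
    (γ : Matrix (Fin N) (Fin N) ℂ) (M : α → ξ → Matrix (Fin m ⊕ Fin N) (Fin m ⊕ Fin N) ℂ) :
    Prop where
  nonneg (k) : 0 ≤ p k
  sum_eq_one : ∑ k, p k = 1
  last_le : p (Fin.last m) ≤ ε
  decay : γ ∈ decayMatrices t
  apply_self (j) : γ j j = p (Fin.last m)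
  posSemidef (a x) : (M a x).PosSemidef
  sum_eq (x) : ∑ a, M a x = stateMatrix p γ

/-- The dataset `⟨ψ_j| M_{a|x} |ψ_j⟩` of the probe vectors `ψ_j`; it is real because the matrices
`M_{a|x}` of interest are positive semidefinite. -/
def certifiedDataset (E : Fin m → ℝ) (t : Fin N → ℝ)
    (M : α → ξ → Matrix (Fin m ⊕ Fin N) (Fin m ⊕ Fin N) ℂ) (a : α) (x : ξ) (j : Fin N) : ℝ :=
  (star (probeVector E t j) ⬝ᵥ (M a x *ᵥ probeVector E t j)).re

/-- The datasets that have a certificate. -/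
def certifiedDatasets (α ξ : Type*) [Fintype α] (E : Fin m → ℝ) (ε : ℝ) (t : Fin N → ℝ) :
    Set (α → ξ → Fin N → ℝ) :=
  {P | ∃ p γ M, IsCertificate ε t p γ M ∧ certifiedDataset E t M = P}

theorem ofReal_certifiedDataset (E : Fin m → ℝ) (t : Fin N → ℝ)
    {M : α → ξ → Matrix (Fin m ⊕ Fin N) (Fin m ⊕ Fin N) ℂ} {a : α} {x : ξ}
    (hM : (M a x).PosSemidef) (j : Fin N) :
    (certifiedDataset E t M a x j : ℂ) =
      star (probeVector E t j) ⬝ᵥ (M a x *ᵥ probeVector E t j) :=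
  (Complex.eq_re_of_ofReal_le (r := 0) (by simpa using hM.dotProduct_mulVec_nonneg _)).symm

theorem continuous_certifiedDataset (E : Fin m → ℝ) (t : Fin N → ℝ) :
    Continuous (certifiedDataset (α := α) (ξ := ξ) E t) := by
  refine continuous_pi fun a => continuous_pi fun x => continuous_pi fun j => ?_
  unfold certifiedDataset
  fun_prop

theorem continuous_stateMatrix :
    Continuous fun c : (Fin (m + 1) → ℝ) × Matrix ι ι ℂ => stateMatrix c.1 c.2 :=
  .matrix_fromBlocks (.matrix_diagonal (by fun_prop)) continuous_const continuous_const
    (by fun_prop)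

theorem isCompact_setOf_norm_apply_le (n : Type*) (r : ℝ) :
    IsCompact {M : Matrix n n ℂ | ∀ i j, ‖M i j‖ ≤ r} := by
  change IsCompact {M : n → n → ℂ | ∀ i j, ‖M i j‖ ≤ r}
  simpa [Set.pi, Set.mem_ofPred_eq] using isCompact_univ_pi fun _ : n =>
    isCompact_univ_pi fun _ : n => isCompact_closedBall (0 : ℂ) r

variable [Fintype α] {ε : ℝ} {t : Fin N → ℝ}

namespace IsCertificate

variable {p : Fin (m + 1) → ℝ} {γ : Matrix (Fin N) (Fin N) ℂ}
  {M : α → ξ → Matrix (Fin m ⊕ Fin N) (Fin m ⊕ Fin N) ℂ}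

theorem le_one (h : IsCertificate ε t p γ M) (k : Fin (m + 1)) : p k ≤ 1 :=
  (Finset.single_le_sum (fun k _ => h.nonneg k) (Finset.mem_univ k)).trans_eq h.sum_eq_one

theorem norm_decay_apply_le_one (h : IsCertificate ε t p γ M) (j k : Fin N) : ‖γ j k‖ ≤ 1 := by
  have hγ := h.decay
  rw [decayMatrices, decayMatricesOn_eq_closure_phaseCone .univ] at hγ
  refine (norm_apply_le_re_apply_self_of_mem_closure_phaseCone hγ j k).trans ?_
  simpa only [h.apply_self, Complex.ofReal_re] using h.le_one (Fin.last m)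

theorem re_apply_self_le_one (h : IsCertificate ε t p γ M) (a : α) (x : ξ) (u : Fin m ⊕ Fin N) :
    (M a x u u).re ≤ 1 := by
  calc (M a x u u).re ≤ ∑ b, (M b x u u).re :=
        Finset.single_le_sum (f := fun b => (M b x u u).re)
          (fun b _ => (Complex.nonneg_iff.1 (h.posSemidef b x).diag_nonneg).1) (Finset.mem_univ a)
    _ = (stateMatrix p γ u u).re := by rw [← h.sum_eq x, Matrix.sum_apply, Complex.re_sum]
    _ ≤ 1 := by
        cases u with
        | inl k => simpa [stateMatrix] using h.le_one k.castSucc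
        | inr j => simpa [stateMatrix, h.apply_self] using h.le_one (Fin.last m)

theorem norm_apply_le_one (h : IsCertificate ε t p γ M) (a : α) (x : ξ) (u w : Fin m ⊕ Fin N) :
    ‖M a x u w‖ ≤ 1 := by
  linarith [norm_apply_le_of_posSemidef (h.posSemidef a x) u w, h.re_apply_self_le_one a x u,
    h.re_apply_self_le_one a x w]

end IsCertificate

theorem isClosed_setOf_isCertificate :
    IsClosed {c : (Fin (m + 1) → ℝ) × Matrix (Fin N) (Fin N) ℂ ×
      (α → ξ → Matrix (Fin m ⊕ Fin N) (Fin m ⊕ Fin N) ℂ) |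
        IsCertificate ε t c.1 c.2.1 c.2.2} := by
  refine isClosed_of_closure_subset fun c hc => ?_
  have key {q : (Fin (m + 1) → ℝ) × Matrix (Fin N) (Fin N) ℂ ×
      (α → ξ → Matrix (Fin m ⊕ Fin N) (Fin m ⊕ Fin N) ℂ) → Prop} (hq : IsClosed {c | q c})
      (h : ∀ c, IsCertificate ε t c.1 c.2.1 c.2.2 → q c) : q c := by
    refine closure_minimal ?_ hq hc
    exact h
  exact
    { nonneg k := key (isClosed_le continuous_const (by fun_prop)) fun _ h => h.nonneg k
      sum_eq_one := key (isClosed_eq (by fun_prop) continuous_const) fun _ h => h.sum_eq_one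
      last_le := key (isClosed_le (by fun_prop) continuous_const) fun _ h => h.last_le
      decay := key (isClosed_closure.preimage (by fun_prop)) fun _ h => h.decay
      apply_self j := key (isClosed_eq (by fun_prop) (by fun_prop)) fun _ h => h.apply_self j
      posSemidef a x := key (isClosed_setOf_posSemidef.preimage (by fun_prop))
        fun _ h => h.posSemidef a x
      sum_eq x := by
        have hright : Continuous fun c : (Fin (m + 1) → ℝ) × Matrix (Fin N) (Fin N) ℂ ×
            (α → ξ → Matrix (Fin m ⊕ Fin N) (Fin m ⊕ Fin N) ℂ) => stateMatrix c.1 c.2.1 :=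
          continuous_stateMatrix.comp (continuous_fst.prodMk (continuous_fst.comp continuous_snd))
        exact key (isClosed_eq (by fun_prop) hright) fun _ h => h.sum_eq x }

theorem isCompact_setOf_isCertificate :
    IsCompact {c : (Fin (m + 1) → ℝ) × Matrix (Fin N) (Fin N) ℂ ×
      (α → ξ → Matrix (Fin m ⊕ Fin N) (Fin m ⊕ Fin N) ℂ) |
        IsCertificate ε t c.1 c.2.1 c.2.2} := by
  have hp : IsCompact (Set.univ.pi fun _ : Fin (m + 1) => Set.Icc (0 : ℝ) 1) :=
    isCompact_univ_pi fun _ => isCompact_Icc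
  have hM := isCompact_univ_pi fun _ : α => isCompact_univ_pi fun _ : ξ =>
    isCompact_setOf_norm_apply_le (Fin m ⊕ Fin N) 1
  refine (hp.prod ((isCompact_setOf_norm_apply_le (Fin N) 1).prod hM)).of_isClosed_subset
    isClosed_setOf_isCertificate fun c hc => ⟨?_, ?_, ?_⟩
  · exact fun k _ => ⟨hc.nonneg k, hc.le_one k⟩
  · exact hc.norm_decay_apply_le_one
  · exact fun a _ x _ => hc.norm_apply_le_one a x

theorem isClosed_certifiedDatasets (E : Fin m → ℝ) :
    IsClosed (certifiedDatasets α ξ E ε t) := by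
  have h : certifiedDatasets α ξ E ε t = (fun c => certifiedDataset E t c.2.2) ''
      {c : (Fin (m + 1) → ℝ) × Matrix (Fin N) (Fin N) ℂ ×
        (α → ξ → Matrix (Fin m ⊕ Fin N) (Fin m ⊕ Fin N) ℂ) |
          IsCertificate ε t c.1 c.2.1 c.2.2} := by
    ext P
    simp [certifiedDatasets]
  rw [h]
  refine (isCompact_setOf_isCertificate.image ?_).isClosed
  exact (continuous_certifiedDataset E t).comp (by fun_prop)

end Certificates

namespace ProjValuedMeasure

open MeasureTheory

variable {𝓗 : Type} [NormedAddCommGroup 𝓗] [InnerProductSpace ℂ 𝓗] [CompleteSpace 𝓗]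

/-- `U` is the unitary group `s ↦ exp (-i H s)` of the operator `H` with spectral measure `Q`. -/
def IsEvolution (Q : ProjValuedMeasure 𝓗) (U : ℝ → 𝓗 →L[ℂ] 𝓗) : Prop :=
  ∀ s, Q.IsIntegral (fun e => phase e s) (U s)

variable {Q : ProjValuedMeasure 𝓗} {U : ℝ → 𝓗 →L[ℂ] 𝓗} {B C : Set ℝ}

theorem isIntegral_one : Q.IsIntegral 1 1 := by
  simpa only [Set.indicator_univ, Q.proj_univ] using Q.isIntegral_indicator_one .univ

theorem star_proj (hB : MeasurableSet B) : star (Q.proj B) = Q.proj B :=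
  (Q.isStarProjection B hB).isSelfAdjoint

theorem proj_mul_self (hB : MeasurableSet B) : Q.proj B * Q.proj B = Q.proj B :=
  (Q.isStarProjection B hB).isIdempotentElem

theorem proj_mul_proj_of_disjoint (hB : MeasurableSet B) (hC : MeasurableSet C)
    (h : Disjoint B C) : Q.proj B * Q.proj C = 0 := by
  rw [← Q.proj_inter B C hB hC, h.inter_eq, Q.proj_empty]

theorem sum_proj_eq_one {ι : Type*} [Fintype ι] {B : ι → Set ℝ} (hB : ∀ k, MeasurableSet (B k))
    (hdisj : Pairwise (Function.onFun Disjoint B))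
    (hnull : ∀ ψ, Q.scalarMeasure ψ (⋃ k, B k)ᶜ = 0) : ∑ k, Q.proj (B k) = 1 := by
  refine IsIntegral.unique (Q := Q) (f := 1) (fun ψ => ?_) isIntegral_one
  have huniv : (Q.scalarMeasure ψ).real Set.univ = ∑ k, (Q.scalarMeasure ψ).real (B k) := by
    rw [← measureReal_iUnion_fintype hdisj hB]
    exact measureReal_congr (ae_eq_univ.2 (hnull ψ)).symm
  rw [sum_apply, inner_sum]
  simp only [Q.inner_proj_self (hB _), ← Q.measureReal_scalarMeasure (hB _), Pi.one_apply,
    integral_const, huniv]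
  simp

namespace IsEvolution

theorem star_apply (hU : Q.IsEvolution U) (s : ℝ) : star (U s) = U (-s) := by
  refine (hU s).star.unique ?_
  convert hU (-s) using 1
  exact funext fun e => star_phase e s

theorem mul (hU : Q.IsEvolution U) (s s' : ℝ) : U s * U s' = U (s + s') := by
  refine ((hU s).mul (hU s') (.phase s) (.phase s')).unique ?_
  convert hU (s + s') using 1
  exact funext fun e => (phase_add_right e s s').symm

theorem apply_zero (hU : Q.IsEvolution U) : U 0 = 1 := by
  refine (hU 0).unique ?_
  convert isIntegral_one (Q := Q) using 1
  exact funext phase_zero_right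

theorem commute_proj (hU : Q.IsEvolution U) (s : ℝ) (hB : MeasurableSet B) :
    Commute (U s) (Q.proj B) :=
  (hU s).commute_proj (.phase s) hB

theorem mul_proj_of_subset_singleton (hU : Q.IsEvolution U) (s : ℝ) (hB : MeasurableSet B) {e : ℝ}
    (hBe : B ⊆ {e}) : U s * Q.proj B = phase e s • Q.proj B := by
  refine ((hU s).mul_proj (.phase s) hB).unique ?_
  convert (Q.isIntegral_indicator_one hB).const_smul (phase e s) using 1
  ext x
  by_cases hx : x ∈ B
  · obtain rfl : x = e := hBe hx
    simp [hx]
  · simp [hx]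

theorem inner_mul_proj (hU : Q.IsEvolution U) (s : ℝ) (hB : MeasurableSet B) (ψ : 𝓗) :
    ⟪ψ, (U s * Q.proj B) ψ⟫_ℂ = ∫ e in B, phase e s ∂Q.scalarMeasure ψ := by
  rw [(hU s).mul_proj (.phase s) hB ψ, ← integral_indicator hB]
  congr 1
  ext e
  by_cases he : e ∈ B <;> simp [he]

theorem star_mul_proj_mul (hU : Q.IsEvolution U) (s s' : ℝ) (hB : MeasurableSet B) :
    star (U s * Q.proj B) * (U s' * Q.proj B) = U (s' - s) * Q.proj B := by
  calc star (U s * Q.proj B) * (U s' * Q.proj B)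
      = Q.proj B * (U (-s) * U s') * Q.proj B := by
        rw [star_mul, star_proj hB, hU.star_apply]
        simp only [mul_assoc]
    _ = U (s' - s) * Q.proj B := by
        rw [hU.mul, ← (hU.commute_proj _ hB).eq, mul_assoc, proj_mul_self hB, neg_add_eq_sub]

end IsEvolution

end ProjValuedMeasure

section EnergyPartition

variable {m : ℕ} {E : Fin m → ℝ} {Eplus : ℝ}

/-- The level sets are made disjoint because `E` may list an energy several times. -/
theorem exists_energyPartition (hE : ∀ k, E k < Eplus) :
    ∃ B : Fin (m + 1) → Set ℝ, (∀ k, MeasurableSet (B k)) ∧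
      Pairwise (Function.onFun Disjoint B) ∧ (∀ k : Fin m, B k.castSucc ⊆ {E k}) ∧
      B (Fin.last m) = Set.Ici Eplus ∧ ⋃ k, B k = Set.range E ∪ Set.Ici Eplus := by
  let f : Fin (m + 1) → Set ℝ := Fin.snoc (fun k => {E k}) (Set.Ici Eplus)
  have hcast (k : Fin m) : f k.castSucc = {E k} := Fin.snoc_castSucc ..
  have hlast : f (Fin.last m) = Set.Ici Eplus := Fin.snoc_last ..
  have hlevel (k : Fin m) : disjointed f k.castSucc ⊆ {E k} :=
    (disjointed_subset f _).trans_eq (hcast k)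
  have hhigh : disjointed f (Fin.last m) = Set.Ici Eplus := by
    rw [disjointed_apply, hlast]
    refine Disjoint.sdiff_eq_left ((Finset.disjoint_sup_right).2 fun k hk => ?_)
    obtain ⟨k, rfl⟩ := Fin.exists_castSucc_eq.2 (Finset.mem_Iio.1 hk).ne
    rw [hcast, Set.disjoint_singleton_right]
    exact not_le.2 (hE k)
  refine ⟨disjointed f, fun k => ?_, disjoint_disjointed f, hlevel, hhigh, ?_⟩
  · refine Fin.lastCases ?_ (fun k => ?_) k
    · rw [hhigh]
      exact measurableSet_Ici
    · exact (Set.subsingleton_singleton.anti (hlevel k)).measurableSet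
  · rw [iUnion_disjointed]
    ext e
    simp [Fin.exists_fin_succ', hcast, hlast, eq_comm]

end EnergyPartition

section Necessity

open ProjValuedMeasure

variable {𝓗 : Type} [NormedAddCommGroup 𝓗] [InnerProductSpace ℂ 𝓗] [CompleteSpace 𝓗]
  {m N : ℕ} {ι : Type*}

section Probe

variable (Q : ProjValuedMeasure 𝓗) (U : ℝ → 𝓗 →L[ℂ] 𝓗) (B : Fin (m + 1) → Set ℝ) (t : ι → ℝ)

/-- The operators into which the evolution operators `U (t j)` decompose: the projections onto the
energy levels and the high-energy parts of the `U (t j)`. The last set of `B` is the set of high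
energies. -/
def probeOperator : Fin m ⊕ ι → 𝓗 →L[ℂ] 𝓗 :=
  Sum.elim (fun k => Q.proj (B k.castSucc)) fun j => U (t j) * Q.proj (B (Fin.last m))

variable (τ : (𝓗 →L[ℂ] 𝓗) →ₚ[ℂ] ℂ)

/-- The weights that the state `τ` gives to the sets of energies `B k`. -/
def energyWeight (k : Fin (m + 1)) : ℝ :=
  (τ (Q.proj (B k))).re

/-- The Gram matrix of the high-energy parts of the evolution operators, with respect to `τ`. -/
def highEnergyMatrix (I : Set ℝ) : Matrix ι ι ℂ :=
  .of fun j k => τ (U (t k - t j) * Q.proj I)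

end Probe

variable {Q : ProjValuedMeasure 𝓗} {U : ℝ → 𝓗 →L[ℂ] 𝓗} {B : Fin (m + 1) → Set ℝ}
  {τ : (𝓗 →L[ℂ] 𝓗) →ₚ[ℂ] ℂ}

theorem sum_probeVector_smul_probeOperator {E : Fin m → ℝ} (hU : Q.IsEvolution U)
    (hB : ∀ k, MeasurableSet (B k)) (hBE : ∀ k : Fin m, B k.castSucc ⊆ {E k})
    (hsum : ∑ k, Q.proj (B k) = 1) (t : Fin N → ℝ) (j : Fin N) :
    ∑ u, probeVector E t j u • probeOperator Q U B t u = U (t j) := by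
  calc ∑ u, probeVector E t j u • probeOperator Q U B t u
      = ∑ k : Fin m, phase (E k) (t j) • Q.proj (B k.castSucc) +
          U (t j) * Q.proj (B (Fin.last m)) := by
        rw [Fintype.sum_sum_type]
        congr 1
        rw [Finset.sum_eq_single j] <;> simp +contextual [probeVector, probeOperator]
    _ = U (t j) * ∑ k, Q.proj (B k) := by
        simp only [Fin.sum_univ_castSucc, mul_add, Finset.mul_sum,
          hU.mul_proj_of_subset_singleton (t j) (hB _) (hBE _)]
    _ = U (t j) := by rw [hsum, mul_one]

theorem ofReal_energyWeight (hB : ∀ k, MeasurableSet (B k)) (k : Fin (m + 1)) :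
    (energyWeight Q B τ k : ℂ) = τ (Q.proj (B k)) := by
  have h : 0 ≤ τ (Q.proj (B k)) := τ.map_nonneg (Q.isStarProjection _ (hB k)).nonneg
  exact (Complex.eq_re_of_ofReal_le (r := 0) (by simpa using h)).symm

theorem energyWeight_nonneg (hB : ∀ k, MeasurableSet (B k)) (k : Fin (m + 1)) :
    0 ≤ energyWeight Q B τ k := by
  rw [← Complex.zero_le_real, ofReal_energyWeight hB]
  exact τ.map_nonneg (Q.isStarProjection _ (hB k)).nonneg

theorem highEnergyMatrix_apply_self (hU : Q.IsEvolution U) (t : ι → ℝ) (I : Set ℝ) (j : ι) :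
    highEnergyMatrix Q U t τ I j j = τ (Q.proj I) := by
  rw [highEnergyMatrix, Matrix.of_apply, sub_self, hU.apply_zero, one_mul]

/-- Distinct energies are orthogonal, so that only the high-energy parts overlap. -/
theorem compressionMatrix_probeOperator_one (hU : Q.IsEvolution U) (hB : ∀ k, MeasurableSet (B k))
    (hdisj : Pairwise (Function.onFun Disjoint B)) (t : ι → ℝ) :
    compressionMatrix τ (probeOperator Q U B t) 1 =
      stateMatrix (energyWeight Q B τ) (highEnergyMatrix Q U t τ (B (Fin.last m))) := by
  have horth (k : Fin m) (j : ι) :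
      Q.proj (B k.castSucc) * (U (t j) * Q.proj (B (Fin.last m))) = 0 := by
    rw [(hU.commute_proj _ (hB _)).eq, ← mul_assoc,
      proj_mul_proj_of_disjoint (hB _) (hB _) (hdisj k.castSucc_lt_last.ne), zero_mul]
  ext u w
  rw [compressionMatrix, Matrix.of_apply, mul_one, stateMatrix]
  rcases u with k | j <;> rcases w with l | j'
  · rw [Matrix.fromBlocks_apply₁₁, probeOperator, Sum.elim_inl, Sum.elim_inl, star_proj (hB _)]
    obtain rfl | hkl := eq_or_ne k l
    · rw [Matrix.diagonal_apply_eq, proj_mul_self (hB _), ofReal_energyWeight hB]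
    · rw [Matrix.diagonal_apply_ne _ hkl, proj_mul_proj_of_disjoint (hB _) (hB _)
        (hdisj (Fin.castSucc_injective m |>.ne hkl)), map_zero]
  · rw [Matrix.fromBlocks_apply₁₂, probeOperator, Sum.elim_inl, Sum.elim_inr, star_proj (hB _),
      horth, map_zero, Matrix.zero_apply]
  · rw [Matrix.fromBlocks_apply₂₁, probeOperator, Sum.elim_inl, Sum.elim_inr,
      ← star_proj (hB l.castSucc), ← star_mul, horth, star_zero, map_zero, Matrix.zero_apply]
  · rw [Matrix.fromBlocks_apply₂₂, probeOperator, Sum.elim_inr, Sum.elim_inr,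
      hU.star_mul_proj_mul _ _ (hB _), highEnergyMatrix, Matrix.of_apply]

theorem highEnergyMatrix_mem_decayMatrices {κ : Type*} (hU : Q.IsEvolution U) {I : Set ℝ}
    (hI : MeasurableSet I) (t : Fin N → ℝ) {v : κ → 𝓗} (hv : Summable fun i => ‖v i‖ ^ 2) :
    highEnergyMatrix Q U t (vectorFunctional hv) I ∈ decayMatrices t := by
  have hsum : HasSum (fun i => Matrix.of fun j k => ⟪v i, (U (t k - t j) * Q.proj I) (v i)⟫_ℂ)
      (highEnergyMatrix Q U t (vectorFunctional hv) I) :=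
    Pi.hasSum.2 fun j => Pi.hasSum.2 fun k => hasSum_vectorFunctional hv _
  rw [decayMatrices, decayMatricesOn_eq_closure_phaseCone .univ]
  let K : PointedCone ℝ (Matrix (Fin N) (Fin N) ℂ) :=
    (phaseCone Set.univ t).topologicalClosure
  refine isClosed_closure.mem_of_tendsto hsum (.of_forall fun s => K.sum_mem fun i _ => ?_)
  refine closure_mono (Submodule.span_mono (Set.image_mono I.subset_univ)) ?_
  exact mem_closure_phaseCone_of_forall_eq_setIntegral hI fun j k =>
    hU.inner_mul_proj (t k - t j) hI (v i)

theorem isCertificate_compressionMatrix {α ξ κ : Type*} [Fintype α] {ε : ℝ} {t : Fin N → ℝ}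
    {v : κ → 𝓗} {hv : Summable fun i => ‖v i‖ ^ 2} (hU : Q.IsEvolution U)
    (hB : ∀ k, MeasurableSet (B k)) (hdisj : Pairwise (Function.onFun Disjoint B))
    (hsum : ∑ k, Q.proj (B k) = 1) (hone : vectorFunctional hv 1 = 1)
    (hε : energyWeight Q B (vectorFunctional hv) (Fin.last m) ≤ ε) {M : α → ξ → 𝓗 →L[ℂ] 𝓗}
    (hM : ∀ a x, 0 ≤ M a x) (hM1 : ∀ x, ∑ a, M a x = 1) :
    IsCertificate ε t (energyWeight Q B (vectorFunctional hv))
      (highEnergyMatrix Q U t (vectorFunctional hv) (B (Fin.last m)))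
      fun a x => compressionMatrix (vectorFunctional hv) (probeOperator Q U B t) (M a x) where
  nonneg := energyWeight_nonneg hB
  sum_eq_one := by
    simp only [energyWeight]
    rw [← Complex.re_sum, ← map_sum, hsum, hone, Complex.one_re]
  last_le := hε
  decay := highEnergyMatrix_mem_decayMatrices hU (hB _) t hv
  apply_self j := by rw [highEnergyMatrix_apply_self hU, ofReal_energyWeight hB]
  posSemidef a x := posSemidef_compressionMatrix _ _ (hM a x)
  sum_eq x := by
    rw [sum_compressionMatrix, hM1, compressionMatrix_probeOperator_one hU hB hdisj]

theorem softSpectralDatasets_subset_certifiedDatasets {A X : ℕ} {E : Fin m → ℝ} {Eplus ε : ℝ}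
    {t : Fin N → ℝ} (hE : ∀ k, E k < Eplus) :
    softSpectralDatasets A X E Eplus ε t ⊆ certifiedDatasets (Fin A) (Fin X) E ε t := by
  rintro P ⟨R, hspec, ⟨w, hw, hwε⟩, hP⟩
  obtain ⟨B, hB, hdisj, hBE, hlast, hunion⟩ := exists_energyPartition hE
  obtain ⟨κ, v, hv, htrace⟩ := exists_vectorFunctional_of_hasTrace R.ρ_pos R.ρ_trace
  have hU : R.Q.IsEvolution R.U := R.U_spec
  have hone : vectorFunctional hv 1 = 1 := by
    simpa using htrace 1 1 1 (by simpa using R.ρ_trace)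
  have hhigh : vectorFunctional hv (R.Q.proj (Set.Ici Eplus)) = w := by
    simpa using htrace 1 (R.Q.proj (Set.Ici Eplus)) w (by simpa using hw)
  have hsum : ∑ k, R.Q.proj (B k) = 1 := by
    refine sum_proj_eq_one hB hdisj fun ψ => MeasureTheory.measure_mono_null ?_
      (R.Q_spec.scalarMeasure_compl_realSpectrum_inter_Ici R.H_selfAdjoint R.H_nonneg ψ)
    rw [hunion, ← hspec, Set.compl_subset_compl]
    exact fun e he => (lt_or_ge e Eplus).imp (fun h => ⟨he.1, he.2, h⟩) id
  refine ⟨_, _, _, isCertificate_compressionMatrix hU hB hdisj hsum hone ?_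
    (fun a x => (R.M a x).nonneg_iff_isPositive.2 (R.M_pos a x)) R.M_sum, ?_⟩
  · rw [energyWeight, hlast, hhigh, Complex.ofReal_re]
    exact hwε
  · ext a x j
    rw [certifiedDataset, dotProduct_compressionMatrix_mulVec,
      sum_probeVector_smul_probeOperator hU hB hBE hsum,
      htrace (R.U (t j)) (R.M a x) (P a x j) (by rw [hU.star_apply]; exact hP a x j),
      Complex.ofReal_re]

end Necessity

theorem hasTrace_mul_rankOne_mul {𝓗 : Type} [NormedAddCommGroup 𝓗] [InnerProductSpace ℂ 𝓗]
    [CompleteSpace 𝓗] (S T : 𝓗 →L[ℂ] 𝓗) (ψ φ : 𝓗) :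
    HasTrace (S * InnerProductSpace.rankOne ℂ ψ φ * T) ⟪φ, T (S ψ)⟫_ℂ := by
  intro ι b
  have hterm (i : ι) : ⟪b i, (S * InnerProductSpace.rankOne ℂ ψ φ * T) (b i)⟫_ℂ =
      ⟪ContinuousLinearMap.adjoint T φ, b i⟫_ℂ * ⟪b i, S ψ⟫_ℂ := by
    simp [ContinuousLinearMap.adjoint_inner_left]
  simp only [hterm, ← ContinuousLinearMap.adjoint_inner_left T]
  exact b.hasSum_inner_mul_inner _ _

theorem hasSum_indicator_one_apply_iUnion {α κ R : Type*} [AddCommMonoid R] [One R]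
    [TopologicalSpace R] {f : κ → Set α} (hf : Pairwise (Function.onFun Disjoint f)) (x : α) :
    HasSum (fun k => (f k).indicator (1 : α → R) x) ((⋃ k, f k).indicator 1 x) := by
  by_cases hx : x ∈ ⋃ k, f k
  · obtain ⟨k, hk⟩ := Set.mem_iUnion.1 hx
    have hzero (l : κ) (hl : l ≠ k) : (f l).indicator (1 : α → R) x = 0 :=
      Set.indicator_of_notMem (fun h => Set.disjoint_left.1 (hf hl) h hk) _
    simpa [hx, hk] using hasSum_single k hzero
  · have hzero (k : κ) : (f k).indicator (1 : α → R) x = 0 :=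
      Set.indicator_of_notMem (fun h => hx (Set.mem_iUnion.2 ⟨k, h⟩)) _
    simp [hx, hzero]

section DiagonalRealization

open MeasureTheory

variable {n : Type} [Fintype n] [DecidableEq n]

theorem isPositive_toEuclideanCLM {M : Matrix n n ℂ} (hM : M.PosSemidef) :
    (Matrix.toEuclideanCLM (n := n) (𝕜 := ℂ) M).IsPositive := by
  rw [← ContinuousLinearMap.isPositive_toLinearMap_iff]
  exact Matrix.isPositive_toEuclideanLin_iff.2 hM

/-- The operator on `ℂ^n` that multiplies the coordinates by `f`. -/
def diagonalOp (f : n → ℂ) : EuclideanSpace ℂ n →L[ℂ] EuclideanSpace ℂ n :=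
  Matrix.toEuclideanCLM (n := n) (𝕜 := ℂ) (Matrix.diagonal f)

@[simp]
theorem diagonalOp_apply (f : n → ℂ) (ψ : EuclideanSpace ℂ n) (i : n) :
    diagonalOp f ψ i = f i * ψ i := by
  rw [diagonalOp, Matrix.ofLp_toEuclideanCLM, Matrix.mulVec_diagonal]

theorem diagonalOp_mul (f g : n → ℂ) : diagonalOp f * diagonalOp g = diagonalOp (f * g) := by
  ext ψ i
  simp [mul_assoc]

theorem diagonalOp_one : diagonalOp (1 : n → ℂ) = 1 := by
  ext ψ i
  simp

theorem star_diagonalOp (f : n → ℂ) : star (diagonalOp f) = diagonalOp (star f) := by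
  rw [diagonalOp, ← map_star, Matrix.star_eq_conjTranspose, Matrix.diagonal_conjTranspose,
    diagonalOp]

theorem inner_diagonalOp (f : n → ℂ) (ψ : EuclideanSpace ℂ n) :
    ⟪ψ, diagonalOp f ψ⟫_ℂ = ∑ i, ((‖ψ i‖ ^ 2 : ℝ) : ℂ) * f i := by
  rw [PiLp.inner_apply]
  refine Finset.sum_congr rfl fun i _ => ?_
  rw [diagonalOp_apply, RCLike.inner_apply, ← Complex.normSq_eq_norm_sq,
    Complex.normSq_eq_conj_mul_self]
  ring

/-- The spectral measure of the diagonal operator with eigenvalues `d`. -/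
def diagonalSpectralMeasure (d : n → ℝ) : ProjValuedMeasure (EuclideanSpace ℂ n) where
  proj B := diagonalOp fun i => B.indicator 1 (d i)
  isStarProjection B _ := by
    constructor
    · rw [IsIdempotentElem, diagonalOp_mul]
      congr 1
      funext i
      by_cases h : d i ∈ B <;> simp [h]
    · rw [IsSelfAdjoint, star_diagonalOp]
      congr 1
      funext i
      by_cases h : d i ∈ B <;> simp [h]
  proj_univ := by
    simp only [Set.indicator_univ, Pi.one_apply]
    exact diagonalOp_one
  proj_inter B C _ _ := by
    rw [diagonalOp_mul]
    congr 1
    funext i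
    rw [Set.inter_indicator_one]
    rfl
  hasSum_iUnion f _ hd ψ := by
    have h : HasSum (fun k => WithLp.ofLp (diagonalOp (fun i => (f k).indicator 1 (d i)) ψ))
        (WithLp.ofLp (diagonalOp (fun i => (⋃ k, f k).indicator 1 (d i)) ψ)) :=
      Pi.hasSum.2 fun i => by
        simpa only [diagonalOp_apply] using
          (hasSum_indicator_one_apply_iUnion hd (d i)).mul_right (ψ i)
    exact h.mapL ((EuclideanSpace.equiv n ℂ).symm : (n → ℂ) →L[ℂ] EuclideanSpace ℂ n)

theorem diagonalSpectralMeasure_proj (d : n → ℝ) (B : Set ℝ) :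
    (diagonalSpectralMeasure d).proj B = diagonalOp fun i => B.indicator 1 (d i) := rfl

theorem scalarMeasure_diagonalSpectralMeasure (d : n → ℝ) (ψ : EuclideanSpace ℂ n) :
    (diagonalSpectralMeasure d).scalarMeasure ψ =
      ∑ i, ENNReal.ofReal (‖ψ i‖ ^ 2) • Measure.dirac (d i) := by
  ext B hB
  rw [ProjValuedMeasure.scalarMeasure_apply _ hB, diagonalSpectralMeasure_proj,
    EuclideanSpace.norm_sq_eq, ENNReal.ofReal_sum_of_nonneg fun i _ => by positivity,
    Measure.coe_finsetSum, Finset.sum_apply]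
  refine Finset.sum_congr rfl fun i _ => ?_
  rw [Measure.smul_apply, Measure.dirac_apply' _ hB]
  by_cases h : d i ∈ B <;> simp [h]

theorem integrable_diagonalSpectralMeasure {F : Type*} [NormedAddCommGroup F] (d : n → ℝ)
    (ψ : EuclideanSpace ℂ n) (f : ℝ → F) :
    Integrable f ((diagonalSpectralMeasure d).scalarMeasure ψ) := by
  rw [scalarMeasure_diagonalSpectralMeasure, integrable_finsetSum_measure]
  exact fun i _ => (integrable_dirac (by simp)).smul_measure ENNReal.ofReal_ne_top

theorem integral_diagonalSpectralMeasure {F : Type*} [NormedAddCommGroup F] [NormedSpace ℝ F]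
    [CompleteSpace F] (d : n → ℝ) (ψ : EuclideanSpace ℂ n) (f : ℝ → F) :
    ∫ e, f e ∂((diagonalSpectralMeasure d).scalarMeasure ψ) = ∑ i, (‖ψ i‖ ^ 2) • f (d i) := by
  rw [scalarMeasure_diagonalSpectralMeasure, integral_finsetSum_measure]
  · refine Finset.sum_congr rfl fun i _ => ?_
    rw [integral_smul_measure, integral_dirac, ENNReal.toReal_ofReal (by positivity)]
  · exact fun i _ => (integrable_dirac (by simp)).smul_measure ENNReal.ofReal_ne_top

theorem isIntegral_diagonalSpectralMeasure (d : n → ℝ) (f : ℝ → ℂ) :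
    (diagonalSpectralMeasure d).IsIntegral f (diagonalOp fun i => f (d i)) := by
  intro ψ
  rw [integral_diagonalSpectralMeasure, inner_diagonalOp]
  simp only [Complex.real_smul]

/-- The diagonal operator with eigenvalues `d`, as an everywhere defined partial operator. -/
def diagonalHamiltonian (d : n → ℝ) : EuclideanSpace ℂ n →ₗ.[ℂ] EuclideanSpace ℂ n :=
  (diagonalOp fun i => (d i : ℂ)).toPMap ⊤

theorem diagonalHamiltonian_apply (d : n → ℝ) (ψ : (diagonalHamiltonian d).domain) :
    diagonalHamiltonian d ψ = diagonalOp (fun i => (d i : ℂ)) (ψ : EuclideanSpace ℂ n) := rfl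

theorem diagonalHamiltonian_apply_sub_smul (d : n → ℝ) (c : ℂ)
    (ψ : (diagonalHamiltonian d).domain) :
    diagonalHamiltonian d ψ - c • (ψ : EuclideanSpace ℂ n) = diagonalOp (fun i => d i - c) ψ := by
  ext i
  simp [diagonalHamiltonian_apply, sub_mul]

theorem isSelfAdjoint_diagonalHamiltonian (d : n → ℝ) : IsSelfAdjoint (diagonalHamiltonian d) := by
  rw [LinearPMap.isSelfAdjoint_def, diagonalHamiltonian,
    ContinuousLinearMap.toPMap_adjoint_eq_adjoint_toPMap_of_dense _ (by simp),
    ← ContinuousLinearMap.star_eq_adjoint, star_diagonalOp]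
  congr 3
  funext i
  simp

theorem isSpectralMeasureOf_diagonalSpectralMeasure (d : n → ℝ) :
    (diagonalSpectralMeasure d).IsSpectralMeasureOf (diagonalHamiltonian d) := by
  refine ⟨fun ψ => ⟨fun _ => integrable_diagonalSpectralMeasure _ _ _,
    fun _ => Submodule.mem_top⟩, fun ψ => ?_⟩
  rw [diagonalHamiltonian_apply, inner_diagonalOp, integral_diagonalSpectralMeasure,
    Complex.ofReal_sum]
  simp only [smul_eq_mul, Complex.ofReal_mul]

theorem realSpectrum_diagonalHamiltonian (d : n → ℝ) :
    realSpectrum (diagonalHamiltonian d) = Set.range d := by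
  ext e
  rw [realSpectrum, Set.mem_ofPred_eq, not_iff_comm]
  constructor
  · intro he
    have hne (i : n) : (d i : ℂ) - e ≠ 0 :=
      sub_ne_zero.2 fun h => he ⟨i, Complex.ofReal_injective h⟩
    refine ⟨diagonalOp fun i => ((d i : ℂ) - e)⁻¹, fun y => ⟨Submodule.mem_top, ?_⟩, fun y => ?_⟩
    · rw [diagonalHamiltonian_apply_sub_smul]
      ext i
      simp [hne i]
    · rw [diagonalHamiltonian_apply_sub_smul]
      ext i
      simp [hne i]
  · rintro ⟨R, -, hR⟩ ⟨i, rfl⟩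
    have hker : diagonalOp (fun k => (d k : ℂ) - d i) (EuclideanSpace.single i 1) = 0 := by
      ext k
      by_cases hk : k = i <;> simp [hk]
    have h := hR ⟨EuclideanSpace.single i 1, Submodule.mem_top⟩
    rw [diagonalHamiltonian_apply_sub_smul, hker, map_zero] at h
    simpa using congrArg (fun v : EuclideanSpace ℂ n => v i) h

variable {A X : ℕ} {d : n → ℝ} {ψ : EuclideanSpace ℂ n} {F : Fin A → Fin X → Matrix n n ℂ}

/-- The quantum realization on `ℂ^n` with the pure state `ψ`, the diagonal Hamiltonian with
energies `d` and the POVMs `F`. -/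
def diagonalRealization (hd : ∀ i, 0 ≤ d i) (hψ : ‖ψ‖ = 1) (hF : ∀ a x, (F a x).PosSemidef)
    (hsum : ∀ x, ∑ a, F a x = 1) : Realization A X where
  𝓗 := EuclideanSpace ℂ n
  ρ := InnerProductSpace.rankOne ℂ ψ ψ
  ρ_pos := InnerProductSpace.isPositive_rankOne_self ψ
  ρ_trace := by
    simpa [inner_self_eq_norm_sq_to_K, hψ] using hasTrace_mul_rankOne_mul 1 1 ψ ψ
  H := diagonalHamiltonian d
  H_selfAdjoint := isSelfAdjoint_diagonalHamiltonian d
  H_nonneg φ := by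
    rw [diagonalHamiltonian_apply, inner_diagonalOp, Complex.re_sum]
    refine Finset.sum_nonneg fun i _ => ?_
    rw [← Complex.ofReal_mul, Complex.ofReal_re]
    exact mul_nonneg (by positivity) (hd i)
  Q := diagonalSpectralMeasure d
  Q_spec := isSpectralMeasureOf_diagonalSpectralMeasure d
  U s := diagonalOp fun i => phase (d i) s
  U_spec s := isIntegral_diagonalSpectralMeasure d fun e => phase e s
  M a x := Matrix.toEuclideanCLM (n := n) (𝕜 := ℂ) (F a x)
  M_pos a x := isPositive_toEuclideanCLM (hF a x)
  M_sum x := by rw [← map_sum, hsum, map_one]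

theorem realSpectrum_diagonalRealization (hd : ∀ i, 0 ≤ d i) (hψ : ‖ψ‖ = 1)
    (hF : ∀ a x, (F a x).PosSemidef) (hsum : ∀ x, ∑ a, F a x = 1) :
    realSpectrum (diagonalRealization hd hψ hF hsum).H = Set.range d :=
  realSpectrum_diagonalHamiltonian d

theorem energyWeightLE_diagonalRealization (hd : ∀ i, 0 ≤ d i) (hψ : ‖ψ‖ = 1)
    (hF : ∀ a x, (F a x).PosSemidef) (hsum : ∀ x, ∑ a, F a x = 1) {B : Set ℝ} {ε : ℝ}
    (hε : ∑ i, B.indicator (fun _ => ‖ψ i‖ ^ 2) (d i) ≤ ε) :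
    (diagonalRealization hd hψ hF hsum).EnergyWeightLE B ε := by
  refine ⟨_, ?_, hε⟩
  have hweight : ⟪ψ, (diagonalSpectralMeasure d).proj B ψ⟫_ℂ =
      ((∑ i, B.indicator (fun _ => ‖ψ i‖ ^ 2) (d i) : ℝ) : ℂ) := by
    rw [diagonalSpectralMeasure_proj, inner_diagonalOp, Complex.ofReal_sum]
    refine Finset.sum_congr rfl fun i _ => ?_
    by_cases h : d i ∈ B <;> simp [h]
  have h := hasTrace_mul_rankOne_mul 1 ((diagonalSpectralMeasure d).proj B) ψ ψ
  rwa [one_mul, one_apply_eq_self, hweight] at h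

theorem yields_diagonalRealization (hd : ∀ i, 0 ≤ d i) (hψ : ‖ψ‖ = 1)
    (hF : ∀ a x, (F a x).PosSemidef) (hsum : ∀ x, ∑ a, F a x = 1) {a : Fin A} {x : Fin X}
    {s q : ℝ} {w : n → ℂ} (hw : ∀ i, w i = phase (d i) s * ψ i)
    (hq : (q : ℂ) = star w ⬝ᵥ (F a x *ᵥ w)) :
    (diagonalRealization hd hψ hF hsum).Yields a x s q := by
  let U (s : ℝ) : EuclideanSpace ℂ n →L[ℂ] EuclideanSpace ℂ n := diagonalOp fun i => phase (d i) s
  let M := Matrix.toEuclideanCLM (n := n) (𝕜 := ℂ) (F a x)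
  have hU : (diagonalSpectralMeasure d).IsEvolution U :=
    fun s => isIntegral_diagonalSpectralMeasure d fun e => phase e s
  have hwU : WithLp.ofLp (U s ψ) = w := funext fun i => by rw [hw, diagonalOp_apply]
  have hvalue : ⟪ψ, (U (-s) * M) (U s ψ)⟫_ℂ = q := by
    rw [hq, ← hU.star_apply, ContinuousLinearMap.star_eq_adjoint, mul_apply_eq_comp,
      ContinuousLinearMap.adjoint_inner_right, EuclideanSpace.inner_eq_star_dotProduct,
      Matrix.ofLp_toEuclideanCLM, hwU, dotProduct_comm]
  have h := hasTrace_mul_rankOne_mul (U s) (U (-s) * M) ψ ψ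
  rwa [hvalue, ← mul_assoc] at h

end DiagonalRealization

section Sufficiency

open scoped Pointwise

variable {κ : Type*} {N m : ℕ} {E : Fin m → ℝ} {e : κ → ℝ} {Eplus ε : ℝ}
  {p : Fin (m + 1) → ℝ} {q : κ → ℝ} {t : Fin N → ℝ}

/-- The pure state with weight `p k` on the `k`-th low energy and `q l` on the `l`-th high one. -/
def amplitudeVector (p : Fin (m + 1) → ℝ) (q : κ → ℝ) : EuclideanSpace ℂ (Fin m ⊕ κ) :=
  WithLp.toLp 2 (Sum.elim (fun k => (√(p k.castSucc) : ℂ)) fun l => (√(q l) : ℂ))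

/-- The matrix that maps the probe vectors to the pure state `amplitudeVector p q` evolved with
the low energies of the probe vectors and the high energies `e`. -/
def amplitudeMatrix (p : Fin (m + 1) → ℝ) (q e : κ → ℝ) (t : Fin N → ℝ) :
    Matrix (Fin m ⊕ κ) (Fin m ⊕ Fin N) ℂ :=
  .fromBlocks (.diagonal fun k => (√(p k.castSucc) : ℂ)) 0 0
    (.of fun l j => √(q l) * phase (e l) (t j))

theorem norm_sq_amplitudeVector_inl (hp : ∀ k, 0 ≤ p k) (k : Fin m) :
    ‖amplitudeVector p q (.inl k)‖ ^ 2 = p k.castSucc := by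
  simp [amplitudeVector, Real.sq_sqrt (hp _)]

theorem norm_sq_amplitudeVector_inr (hq : ∀ l, 0 ≤ q l) (l : κ) :
    ‖amplitudeVector p q (.inr l)‖ ^ 2 = q l := by
  simp [amplitudeVector, Real.sq_sqrt (hq _)]

theorem amplitudeMatrix_mulVec_probeVector (j : Fin N) (u : Fin m ⊕ κ) :
    (amplitudeMatrix p q e t *ᵥ probeVector E t j) u =
      phase (Sum.elim E e u) (t j) * amplitudeVector p q u := by
  rw [amplitudeMatrix, probeVector, Matrix.fromBlocks_mulVec]
  cases u with
  | inl k => simp [Matrix.mulVec_diagonal, amplitudeVector, phase, mul_comm]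
  | inr l => simp [amplitudeVector, mul_comm]

theorem range_sumElim_inter_Ico (hE : ∀ k, 0 ≤ E k ∧ E k < Eplus) (he : ∀ l, Eplus ≤ e l) :
    Set.range (Sum.elim E e) ∩ Set.Ico 0 Eplus = Set.range E := by
  have hhigh : Disjoint (Set.range e) (Set.Ico 0 Eplus) :=
    Set.disjoint_left.2 <| by
      rintro _ ⟨l, rfl⟩ h
      exact (he l).not_gt h.2
  rw [Set.Sum.elim_range, Set.union_inter_distrib_right, hhigh.inter_eq, Set.union_empty,
    Set.inter_eq_left]
  exact Set.range_subset_iff.2 hE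

theorem exists_sum_smul_phaseMatrix_of_mem_smul_convexHull {ι : Type*} {I : Set ℝ} {s : ι → ℝ}
    {γ : Matrix ι ι ℂ} {c : ℝ} (hc : 0 ≤ c) (hγ : γ ∈ c • convexHull ℝ (phaseMatrix s '' I)) :
    ∃ (κ : Type) (_ : Fintype κ) (q e : κ → ℝ), (∀ l, 0 ≤ q l) ∧ ∑ l, q l = c ∧
      (∀ l, e l ∈ I) ∧ ∑ l, q l • phaseMatrix s (e l) = γ := by
  obtain ⟨δ, hδ, rfl⟩ := hγ
  obtain ⟨κ, _, w, z, hw, hw1, hz, rfl⟩ := mem_convexHull_iff_exists_fintype.1 hδ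
  choose e he hez using hz
  refine ⟨κ, ‹_›, fun l => c * w l, e, fun l => mul_nonneg hc (hw l), ?_, he, ?_⟩
  · rw [← Finset.mul_sum, hw1, mul_one]
  · simp only [hez, mul_smul, Finset.smul_sum]

variable [Fintype κ]

theorem norm_amplitudeVector (hp : ∀ k, 0 ≤ p k) (hq : ∀ l, 0 ≤ q l)
    (hpq : ∑ l, q l = p (Fin.last m)) (hp1 : ∑ k, p k = 1) : ‖amplitudeVector p q‖ = 1 := by
  rw [← pow_eq_one_iff_of_nonneg (norm_nonneg _) two_ne_zero, EuclideanSpace.norm_sq_eq,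
    Fintype.sum_sum_type]
  simp only [norm_sq_amplitudeVector_inl hp, norm_sq_amplitudeVector_inr hq]
  rw [hpq, ← Fin.sum_univ_castSucc, hp1]

theorem conjTranspose_amplitudeMatrix_mul_self (hp : ∀ k, 0 ≤ p k) (hq : ∀ l, 0 ≤ q l)
    (e : κ → ℝ) (t : Fin N → ℝ) :
    (amplitudeMatrix p q e t)ᴴ * amplitudeMatrix p q e t =
      stateMatrix p (∑ l, q l • phaseMatrix t (e l)) := by
  have hsq {r : ℝ} (hr : 0 ≤ r) : (√r : ℂ) * √r = r := by
    rw [← Complex.ofReal_mul, Real.mul_self_sqrt hr]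
  rw [amplitudeMatrix, stateMatrix, Matrix.fromBlocks_conjTranspose, Matrix.fromBlocks_multiply]
  simp only [Matrix.conjTranspose_zero, Matrix.mul_zero, Matrix.zero_mul, add_zero, zero_add]
  congr 1
  · rw [Matrix.diagonal_conjTranspose, Matrix.diagonal_mul_diagonal]
    congr 1
    funext k
    simpa using hsq (hp k.castSucc)
  · ext j k
    rw [Matrix.mul_apply, Matrix.sum_apply]
    refine Finset.sum_congr rfl fun l _ => ?_
    rw [Matrix.conjTranspose_apply, Matrix.of_apply, Matrix.of_apply, star_mul', star_phase,
      RCLike.star_def, Complex.conj_ofReal, Matrix.smul_apply, phaseMatrix_apply,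
      Complex.real_smul, sub_eq_neg_add, phase_add_right, ← hsq (hq l)]
    ring

theorem posSemidef_stateMatrix_of_mem_smul_convexHull {I : Set ℝ} {γ : Matrix (Fin N) (Fin N) ℂ}
    (hp : ∀ k, 0 ≤ p k) {c : ℝ} (hc : 0 ≤ c) (hγ : γ ∈ c • convexHull ℝ (phaseMatrix t '' I)) :
    (stateMatrix p γ).PosSemidef := by
  obtain ⟨κ, _, q, e, hq, -, -, rfl⟩ := exists_sum_smul_phaseMatrix_of_mem_smul_convexHull hc hγ
  rw [← conjTranspose_amplitudeMatrix_mul_self hp hq]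
  exact Matrix.posSemidef_conjTranspose_mul_self _

theorem sum_indicator_Ici_norm_sq_amplitudeVector (hE : ∀ k, E k < Eplus) (he : ∀ l, Eplus ≤ e l)
    (hq : ∀ l, 0 ≤ q l) :
    ∑ u, (Set.Ici Eplus).indicator (fun _ => ‖amplitudeVector p q u‖ ^ 2) (Sum.elim E e u) =
      ∑ l, q l := by
  rw [Fintype.sum_sum_type]
  simp [norm_sq_amplitudeVector_inr hq, he, hE]

variable {A X : ℕ} {γ : Matrix (Fin N) (Fin N) ℂ}

theorem certifiedDataset_mem_softSpectralDatasets (hA : 0 < A)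
    (hE : ∀ k, 0 ≤ E k ∧ E k < Eplus) (hp : ∀ k, 0 ≤ p k) (hp1 : ∑ k, p k = 1)
    (hpε : p (Fin.last m) ≤ ε)
    (hγ : γ ∈ p (Fin.last m) • convexHull ℝ (phaseMatrix t '' Set.Ici (max Eplus 0)))
    {M : Fin A → Fin X → Matrix (Fin m ⊕ Fin N) (Fin m ⊕ Fin N) ℂ}
    (hM : ∀ a x, (M a x).PosSemidef) (hsum : ∀ x, ∑ a, M a x = stateMatrix p γ) :
    certifiedDataset E t M ∈ softSpectralDatasets A X E Eplus ε t := by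
  classical
  have : Nonempty (Fin A) := Fin.pos_iff_nonempty.1 hA
  obtain ⟨κ, _, q, e, hq, hqp, he, rfl⟩ :=
    exists_sum_smul_phaseMatrix_of_mem_smul_convexHull (hp _) hγ
  have heE (l : κ) : Eplus ≤ e l := (le_max_left _ _).trans (he l)
  have hd : ∀ u, 0 ≤ Sum.elim E e u := Sum.rec (fun k => (hE k).1) fun l =>
    (le_max_right _ _).trans (he l)
  let W := amplitudeMatrix p q e t
  choose F hF hF1 hFM using fun x => exists_povm_of_sum_eq_conjTranspose_mul_self
    (hM · x) (W := W) (by rw [hsum, conjTranspose_amplitudeMatrix_mul_self hp hq])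
  refine ⟨diagonalRealization hd (norm_amplitudeVector hp hq hqp hp1) (fun a x => hF x a) hF1,
    ?_, ?_, fun a x j => ?_⟩
  · rw [realSpectrum_diagonalRealization, range_sumElim_inter_Ico hE heE]
  · refine energyWeightLE_diagonalRealization _ _ _ _ ?_
    rwa [sum_indicator_Ici_norm_sq_amplitudeVector (fun k => (hE k).2) heE hq, hqp]
  · refine yields_diagonalRealization _ _ _ _ (amplitudeMatrix_mulVec_probeVector j) ?_
    rw [ofReal_certifiedDataset E t (hM a x), ← hFM x a, Matrix.star_mulVec,
      ← Matrix.mulVec_mulVec, ← Matrix.mulVec_mulVec, Matrix.dotProduct_mulVec]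

/-- Splitting the perturbed matrices `stateMatrix p γ'`, for `γ'` in the convex hull near `γ`, as
`stateMatrix p γ` is split by `M` keeps the dataset close to the given one. -/
theorem IsCertificate.certifiedDataset_mem_closure (hA : 0 < A)
    (hE : ∀ k, 0 ≤ E k ∧ E k < Eplus)
    {M : Fin A → Fin X → Matrix (Fin m ⊕ Fin N) (Fin m ⊕ Fin N) ℂ}
    (h : IsCertificate ε t p γ M) :
    certifiedDataset E t M ∈ closure (softSpectralDatasets A X E Eplus ε t) := by
  have : Nonempty (Fin A) := Fin.pos_iff_nonempty.1 hA
  let K := p (Fin.last m) • convexHull ℝ (phaseMatrix t '' Set.Ici (max Eplus 0))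
  have hK {γ'} (hγ' : γ' ∈ K) : (stateMatrix p γ').PosSemidef :=
    posSemidef_stateMatrix_of_mem_smul_convexHull h.nonneg (h.nonneg _) hγ'
  choose Φ hcont hΦM hΦ using fun x => exists_continuousOn_decomposition (h.posSemidef · x)
  let f (γ' : Matrix (Fin N) (Fin N) ℂ) := certifiedDataset E t fun a x => Φ x (stateMatrix p γ') a
  have hfγ : f γ = certifiedDataset E t M :=
    congrArg (certifiedDataset E t) <| funext fun a => funext fun x => by
      rw [← h.sum_eq x, hΦM]
  have hγ : γ ∈ closure K := by
    refine mem_closure_smul_convexHull_phaseMatrix Set.nonempty_Ici ?_ (h.nonneg _) h.apply_self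
    rw [← decayMatricesOn_eq_closure_phaseCone measurableSet_Ici, decayMatricesOn_Ici]
    exact h.decay
  have hf : ContinuousWithinAt f K γ := by
    refine (continuous_certifiedDataset E t).continuousAt.comp_continuousWithinAt ?_
    refine continuousWithinAt_pi.2 fun a => continuousWithinAt_pi.2 fun x => ?_
    have hpsd : (stateMatrix p γ).PosSemidef := by
      rw [← h.sum_eq x]
      exact Matrix.posSemidef_sum _ fun a _ => h.posSemidef a x
    have hstate : Continuous fun γ' : Matrix (Fin N) (Fin N) ℂ => stateMatrix p γ' :=
      continuous_stateMatrix.comp (Continuous.prodMk_right p)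
    exact (continuous_apply a).continuousAt.comp_continuousWithinAt
      ((hcont x _ hpsd).comp hstate.continuousWithinAt fun _ => hK)
  rw [← hfγ]
  refine closure_mono (Set.image_subset_iff.2 fun γ' hγ' => ?_) (hf.mem_closure_image hγ)
  exact certifiedDataset_mem_softSpectralDatasets hA hE h.nonneg h.sum_eq_one h.last_le hγ'
    (fun a x => (hΦ x _ (hK hγ')).1 a) fun x => (hΦ x _ (hK hγ')).2

theorem closure_softSpectralDatasets (hA : 0 < A) (hE : ∀ k, 0 ≤ E k ∧ E k < Eplus) :
    closure (softSpectralDatasets A X E Eplus ε t) =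
      certifiedDatasets (Fin A) (Fin X) E ε t := by
  refine (closure_minimal (softSpectralDatasets_subset_certifiedDatasets fun k => (hE k).2)
    (isClosed_certifiedDatasets E)).antisymm ?_
  rintro _ ⟨p, γ, M, h, rfl⟩
  exact h.certifiedDataset_mem_closure hA hE

end Sufficiency

section Normalization

variable {α ξ : Type*} {N m : ℕ} {E : Fin m → ℝ} {ε : ℝ} {t : Fin N → ℝ}

theorem dotProduct_stateMatrix_mulVec_probeVector (p : Fin (m + 1) → ℝ)
    (γ : Matrix (Fin N) (Fin N) ℂ) (j : Fin N) :
    star (probeVector E t j) ⬝ᵥ (stateMatrix p γ *ᵥ probeVector E t j) =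
      ∑ k : Fin m, (p k.castSucc : ℂ) + γ j j := by
  have hphase (k : Fin m) : star (phase (E k) (t j)) * phase (E k) (t j) = 1 := by
    rw [star_phase, ← phase_add_right, neg_add_cancel, phase_zero_right]
  rw [probeVector, stateMatrix, Matrix.fromBlocks_mulVec, dotProduct, Fintype.sum_sum_type]
  congr 1
  · refine Finset.sum_congr rfl fun k _ => ?_
    simp only [Pi.star_apply, Sum.elim_inl, Function.comp_def, Matrix.zero_mulVec, add_zero,
      Matrix.mulVec_diagonal]
    rw [mul_left_comm]
    exact (congrArg _ (hphase k)).trans (mul_one _)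
  · simp [Pi.single_apply, apply_ite]

variable [Fintype α]

theorem apply_self_eq_last_of_sum_eq_one {P : α → ξ → Fin N → ℝ} (hP : ∀ x j, ∑ a, P a x j = 1)
    {p : Fin (m + 1) → ℝ} (hp1 : ∑ k, p k = 1) {γ : Matrix (Fin N) (Fin N) ℂ}
    {M : α → ξ → Matrix (Fin m ⊕ Fin N) (Fin m ⊕ Fin N) ℂ} {x : ξ}
    (hsum : ∑ a, M a x = stateMatrix p γ)
    (hPM : ∀ a j, (P a x j : ℂ) =
      star (probeVector E t j) ⬝ᵥ (M a x *ᵥ probeVector E t j)) (j : Fin N) :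
    γ j j = p (Fin.last m) := by
  have h : ((∑ a, P a x j : ℝ) : ℂ) = ∑ k : Fin m, (p k.castSucc : ℂ) + γ j j := by
    rw [← dotProduct_stateMatrix_mulVec_probeVector (E := E) (t := t), ← hsum, Matrix.sum_mulVec,
      dotProduct_sum, Complex.ofReal_sum]
    exact Finset.sum_congr rfl fun a _ => hPM a j
  rw [hP, ← hp1, Fin.sum_univ_castSucc, Complex.ofReal_add, Complex.ofReal_sum] at h
  exact (add_left_cancel h).symm

/-- Without settings the probe vectors do not normalize `γ`, which has to be replaced. -/
theorem mem_certifiedDatasets_iff {P : α → ξ → Fin N → ℝ} (hP : ∀ x j, ∑ a, P a x j = 1) :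
    P ∈ certifiedDatasets α ξ E ε t ↔
      ∃ (p : Fin (m + 1) → ℝ) (γ : Matrix (Fin N) (Fin N) ℂ)
        (M : α → ξ → Matrix (Fin m ⊕ Fin N) (Fin m ⊕ Fin N) ℂ),
        (∀ k, 0 ≤ p k) ∧ ∑ k, p k = 1 ∧ γ ∈ decayMatrices t ∧ p (Fin.last m) ≤ ε ∧
        (∀ a x, (M a x).PosSemidef) ∧ (∀ x, ∑ a, M a x = stateMatrix p γ) ∧
        ∀ a x j, (P a x j : ℂ) = star (probeVector E t j) ⬝ᵥ (M a x *ᵥ probeVector E t j) := by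
  constructor
  · rintro ⟨p, γ, M, h, rfl⟩
    exact ⟨p, γ, M, h.nonneg, h.sum_eq_one, h.decay, h.last_le, h.posSemidef, h.sum_eq,
      fun a x => ofReal_certifiedDataset E t (h.posSemidef a x)⟩
  · rintro ⟨p, γ, M, hp, hp1, hγ, hpε, hM, hsum, hPM⟩
    have hPeq : certifiedDataset E t M = P := by
      ext a x j
      exact Complex.ofReal_injective
        ((ofReal_certifiedDataset E t (hM a x) j).trans (hPM a x j).symm)
    obtain hξ | ⟨⟨x⟩⟩ := isEmpty_or_nonempty ξ
    · refine ⟨p, p (Fin.last m) • phaseMatrix t 0, M, ⟨hp, hp1, hpε, ?_, ?_, hM, hξ.elim⟩, hPeq⟩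
      · rw [decayMatrices, decayMatricesOn_eq_closure_phaseCone .univ]
        exact subset_closure
          ((phaseCone _ t).smul_mem (hp _) (phaseMatrix_mem_phaseCone (Set.mem_univ 0)))
      · simp
    · exact ⟨p, γ, M, ⟨hp, hp1, hpε, hγ, apply_self_eq_last_of_sum_eq_one hP hp1 (hsum x)
        fun a => hPM a x, hM, hsum⟩, hPeq⟩

end Normalization

end

theorem mainTheorem7 {N : ℕ} (t : Fin N → ℝ) :
    (∀ (A X m : ℕ) (E : Fin m → ℝ) (Eplus ε : ℝ), 0 < A →
      (∀ k, 0 ≤ E k ∧ E k < Eplus) →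
      ∀ P : Fin A → Fin X → Fin N → ℝ, IsDataset P →
      (P ∈ closure (softSpectralDatasets A X E Eplus ε t) ↔
        ∃ (p : Fin (m + 1) → ℝ) (γ : Matrix (Fin N) (Fin N) ℂ)
          (M : Fin A → Fin X → Matrix (Fin m ⊕ Fin N) (Fin m ⊕ Fin N) ℂ),
          (∀ k, 0 ≤ p k) ∧ ∑ k, p k = 1 ∧
          γ ∈ decayMatrices t ∧
          p (Fin.last m) ≤ ε ∧
          (∀ a x, (M a x).PosSemidef) ∧
          (∀ x, ∑ a, M a x =
            Matrix.fromBlocks (Matrix.diagonal fun k : Fin m => (p k.castSucc : ℂ)) 0 0 γ) ∧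
          ∀ a x j, (P a x j : ℂ) =
            star (probeVector E t j) ⬝ᵥ (M a x *ᵥ probeVector E t j))) ∧
    ∀ Eplus : ℝ, decayMatricesOn (Set.Ici Eplus) t = decayMatrices t := by
  refine ⟨fun A X m E Eplus ε hA hE P hP => ?_, decayMatricesOn_Ici t⟩
  rw [closure_softSpectralDatasets hA hE]
  exact mem_certifiedDatasets_iff hP.2
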